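/- Let $N\ge 2$, let $\mathcal G$ be a connected undirected (simple, unweighted) graph on $\{1,\dots,N\}$ with adjacency matrix $[a_{ij}]$, $a_{ij}\in\{0,1\}$, and let $\lambda_2\le\dots\le\lambda_N$ be the nonzero eigenvalues of its Laplacian. Let $A\in\mathbf R^{n\times n}$ and $B\in\mathbf R^{n\times 1}$ be such that $(A,B)$ is stabilizable, and consider $N$ agents $$x_i(k+1)=Ax_i(k)+Bu_i(k),\qquad u_i(k)=\alpha\sum_{j=1}^N a_{ij}\,[1+\Delta_{ij}(k)]\,K\,[x_i(k)-x_j(k)],\qquad i=1,\dots,N,$$ where $\alpha>0$ and $K\in\mathbf R^{1\times n}$. Here the $\Delta_{ij}(k)$, for ordered pairs $(i,j)$ of adjacent nodes and $k=0,1,2,\dots$, are mutually independent real random variables with $\mathbf E\{\Delta_{ij}(k)\}=0$ and $\mathbf E\{\Delta_{ij}(k)^2\}=\sigma_{ij}^2<\infty$, and the initial states $x_i(0)$ are square-integrable and jointly independent of all the $\Delta_{ij}(k)$ (for instance, deterministic). The pair $(\alpha,K)$ is said to solve the mean square consensus problem if, for all such uncertainties and initial states, $\mathbf E\{\|x_i(k)-x_j(k)\|^2\}$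 is finite for all $k$ and $\lim_{k\to\infty}\mathbf E\{\|x_i(k)-x_j(k)\|^2\}=0$, for all $i,j$. Put $\sigma_{\max}^2=\max(\sigma_{ij}^2+\sigma_{ji}^2)$, the maximum being over the edges $\{i,j\}$ of $\mathcal G$, and let $M(A)=\prod_{l=1}^n\max\{1,|\lambda_l(A)|\}$ be the Mahler measure of $A$, where $\lambda_1(A),\dots,\lambda_n(A)$ are the complex eigenvalues of $A$ with multiplicity. Suppose that $\alpha>0$ satisfies $$(\alpha\lambda_i-1)^2+\alpha^2\sigma_{\max}^2\lambda_i<\frac1{M(A)^2},\qquad i=2\text{ and }i=N.$$ Then there is a gain $K$ such that $(\alpha,K)$ solves the mean square consensus problem. Furthermore, let $Q$ be any symmetric positive definite matrix and let $\breve\delta\in\mathbf R$ be any number with $$\max_{i\in\{2,N\}}\{(\alpha\lambda_i-1)^2+\alpha^2\sigma_{\max}^2\lambda_i\}\le\breve\delta^2<\frac1{M(A)^2}.$$ Then the modified algebraic Riccati equation $$P=A^TPA-(1-\breve\delta^2)A^TPB(B^TPB)^{-1}B^TPA+Q$$ has a unique symmetric positive definite solution $P$, and $(\alpha,K)$ with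 $K=-(B^TPB)^{-1}B^TPA$ solves the mean square consensus problem. (If $B=0$, the expression $(B^TPB)^{-1}$ is read as $0$.) -/

import Mathlib

open MeasureTheory ProbabilityTheory Filter Topology
open scoped Matrix

universe u

noncomputable section

/-- A real square matrix is Schur stable: all its complex eigenvalues lie in the open unit disc. -/
def IsSchurStable {n : ℕ} (A : Matrix (Fin n) (Fin n) ℝ) : Prop :=
  ∀ z ∈ spectrum ℂ (A.map (algebraMap ℝ ℂ)), ‖z‖ < 1

/-- The pair `(A, B)` (single input) is stabilizable: some state feedback makes it Schur stable. -/
def IsStabilizable {n : ℕ} (A : Matrix (Fin n) (Fin n) ℝ) (B : Matrix (Fin n) (Fin 1) ℝ) : Prop :=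
  ∃ F : Matrix (Fin 1) (Fin n) ℝ, IsSchurStable (A + B * F)

/-- The Mahler measure `∏ max {1, |λ_i(A)|}` of a real matrix, the product running over the
complex eigenvalues counted with algebraic multiplicity. -/
def matrixMahlerMeasure {n : ℕ} (A : Matrix (Fin n) (Fin n) ℝ) : ℝ :=
  ((A.map (algebraMap ℝ ℂ)).charpoly.roots.map fun z => max 1 ‖z‖).prod

/-- The modified algebraic Riccati equation
`P = AᵀPA - (1 - δ²) AᵀPB (BᵀPB)⁻¹ BᵀPA + Q`. -/
def SolvesMARE {n : ℕ} (A : Matrix (Fin n) (Fin n) ℝ) (B : Matrix (Fin n) (Fin 1) ℝ)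
    (Q : Matrix (Fin n) (Fin n) ℝ) (δ : ℝ) (P : Matrix (Fin n) (Fin n) ℝ) : Prop :=
  P = Aᵀ * P * A - (1 - δ ^ 2) • (Aᵀ * P * B * (Bᵀ * P * B)⁻¹ * Bᵀ * P * A) + Q

/-- The feedback gain `K = -(BᵀPB)⁻¹ BᵀPA`. -/
def mareGain {n : ℕ} (A : Matrix (Fin n) (Fin n) ℝ) (B : Matrix (Fin n) (Fin 1) ℝ)
    (P : Matrix (Fin n) (Fin n) ℝ) : Matrix (Fin 1) (Fin n) ℝ :=
  -((Bᵀ * P * B)⁻¹ * Bᵀ * P * A)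

/-- The set of nonzero eigenvalues of the Laplacian matrix of `G`. -/
def nonzeroLapEigenvalues {N : ℕ} (G : SimpleGraph (Fin N)) [DecidableRel G.Adj] : Set ℝ :=
  {l | l ≠ 0 ∧ Module.End.HasEigenvalue (Matrix.toLin' (G.lapMatrix ℝ)) l}

/-- The set of the numbers `σ_ij² + σ_ji²`, where `{i, j}` runs over the edges of `G`. -/
def edgeVariances {N : ℕ} (G : SimpleGraph (Fin N)) (σ : Fin N → Fin N → ℝ) : Set ℝ :=
  {s | ∃ i j, G.Adj i j ∧ s = σ i j ^ 2 + σ j i ^ 2}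

/-- The control input `u_i = α ∑_j a_ij (1 + Δ_ij) K (x_i - x_j)` of agent `i`. -/
def protocolInput {N n : ℕ} (G : SimpleGraph (Fin N)) [DecidableRel G.Adj]
    (α : ℝ) (K : Matrix (Fin 1) (Fin n) ℝ) (D : Fin N → Fin N → ℝ) (x : Fin N → Fin n → ℝ)
    (i : Fin N) : Fin 1 → ℝ :=
  α • ∑ j, (G.adjMatrix ℝ i j * (1 + D i j)) • (K *ᵥ (x i - x j))

/-- The states `x_i(k)` of the agents `x_i(k+1) = A x_i(k) + B u_i(k)` under the protocol, for the
channel uncertainties `Δ` and the initial states `x₀`. -/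
def agentState {N n : ℕ} {Ω : Type*} (G : SimpleGraph (Fin N)) [DecidableRel G.Adj]
    (A : Matrix (Fin n) (Fin n) ℝ) (B : Matrix (Fin n) (Fin 1) ℝ)
    (α : ℝ) (K : Matrix (Fin 1) (Fin n) ℝ) (Δ : Fin N → Fin N → ℕ → Ω → ℝ)
    (x₀ : Ω → Fin N → Fin n → ℝ) : ℕ → Ω → Fin N → Fin n → ℝ
  | 0 => x₀
  | k + 1 => fun ω i =>
      A *ᵥ agentState G A B α K Δ x₀ k ω i +
        B *ᵥ protocolInput G α K (fun i j => Δ i j k ω) (agentState G A B α K Δ x₀ k ω) i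

/-- The uncertainties `Δ_ij(k)`, for ordered pairs `(i, j)` of adjacent nodes (darts of `G`) and
times `k`, are mutually independent square-integrable random variables with mean zero and
variance `σ_ij²`. -/
structure IsChannelNoise {N : ℕ} {Ω : Type*} [MeasurableSpace Ω] (μ : Measure Ω)
    (G : SimpleGraph (Fin N)) (σ : Fin N → Fin N → ℝ) (Δ : Fin N → Fin N → ℕ → Ω → ℝ) : Prop where
  measurable : ∀ i j, G.Adj i j → ∀ k, Measurable (Δ i j k)
  memLp : ∀ i j, G.Adj i j → ∀ k, MemLp (Δ i j k) 2 μ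
  mean : ∀ i j, G.Adj i j → ∀ k, ∫ ω, Δ i j k ω ∂μ = 0
  sq_mean : ∀ i j, G.Adj i j → ∀ k, ∫ ω, Δ i j k ω ^ 2 ∂μ = σ i j ^ 2
  indep : iIndepFun (fun (e : G.Dart × ℕ) => Δ e.1.fst e.1.snd e.2) μ

/-- The initial states are square-integrable random vectors independent of the channel
uncertainties (for instance, they are deterministic). -/
structure IsInitialState {N n : ℕ} {Ω : Type*} [MeasurableSpace Ω] (μ : Measure Ω)
    (G : SimpleGraph (Fin N)) (Δ : Fin N → Fin N → ℕ → Ω → ℝ)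
    (x₀ : Ω → Fin N → Fin n → ℝ) : Prop where
  measurable : Measurable x₀
  memLp : ∀ i a, MemLp (fun ω => x₀ ω i a) 2 μ
  indep : IndepFun x₀ (fun ω (e : G.Dart × ℕ) => Δ e.1.fst e.1.snd e.2 ω) μ

/-- The protocol with scaling factor `α` and gain `K` solves the mean square consensus problem:
for all uncertainties with the variances `σ_ij²`, on any probability space, and all initial states,
`E ‖x_i(k) - x_j(k)‖² → 0` (Euclidean norm, all the expectations being finite) for all `i, j`. -/
def SolvesMeanSquareConsensus {N n : ℕ} (G : SimpleGraph (Fin N)) [DecidableRel G.Adj]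
    (A : Matrix (Fin n) (Fin n) ℝ) (B : Matrix (Fin n) (Fin 1) ℝ) (σ : Fin N → Fin N → ℝ)
    (α : ℝ) (K : Matrix (Fin 1) (Fin n) ℝ) : Prop :=
  ∀ (Ω : Type u) [MeasurableSpace Ω] (μ : Measure Ω) [IsProbabilityMeasure μ]
    (Δ : Fin N → Fin N → ℕ → Ω → ℝ) (x₀ : Ω → Fin N → Fin n → ℝ),
    IsChannelNoise μ G σ Δ → IsInitialState μ G Δ x₀ → ∀ i j : Fin N,
      (∀ k, Integrable (fun ω => ‖WithLp.toLp 2 (agentState G A B α K Δ x₀ k ω i -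
        agentState G A B α K Δ x₀ k ω j)‖ ^ 2) μ) ∧
      Tendsto (fun k => ∫ ω, ‖WithLp.toLp 2 (agentState G A B α K Δ x₀ k ω i -
        agentState G A B α K Δ x₀ k ω j)‖ ^ 2 ∂μ) atTop (𝓝 0)

end

/-! ### Quadratic forms of real symmetric matrices -/

section QuadraticForms

variable {n : ℕ}

/-! Write `b` for the column of `B`, `e_i` for the deviation of agent `i` from the average state,
`ζ_i = K e_i`, `L` for the Laplacian and `β = bᵀPb`. The proof shows that `V = ∑ e_iᵀ P e_i` decays
geometrically in mean.

Consensus. The gain satisfies `bᵀPA e_i = -β ζ_i`. The noise at time `k` is centred and independent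
of the state, so `E V` after one step is at most the mean of `∑ (A e_i)ᵀ P (A e_i) + β (α² |Lζ|² -
2α ζᵀLζ + α² ∑ a_ij σ_ij² (ζ_i - ζ_j)²)`. Pairing the two directions of every edge bounds the noise
sum by `σ_max² ζᵀLζ` (`sum_variance_le`). Since `ζ` has mean zero, it only sees the nonzero spectrum
of `L`; the convex quadratic `(αλ - 1)² + α² σ_max² λ` is at most `δ²` at both ends of that
spectrum, hence on all of it, and the bracket is at most `-(1 - δ²) |ζ|²`
(`lapMatrix_quadratic_bound`). The Riccati equation says exactly that what remains is `V - ∑ e_iᵀ Q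
e_i` (`disagreement_meanStep_add_noise_le`).

Solvability. The Riccati map is an infimum over feedbacks of monotone affine maps, so it is
monotone, and iterating it from `Q` converges below any supersolution (`exists_riccati_solution`). A
supersolution comes from the regulator problem with unit input cost (`r = 1`) and state cost `ε`. As
`ε → 0` its solutions accumulate at a semidefinite `P₀` solving the homogeneous equation, and
comparing determinants modulo `ker P₀` gives `1 + bᵀP₀b ≤ M(A)²` (`riccati_solution_bound`). Hence
`δ² (1 + bᵀPb) < 1` for some small `ε`, which makes a multiple of `P` a supersolution of the
modified equation (`r = 0`). Uniqueness is a contraction argument (`riccati_solution_le`). -/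

theorem Matrix.IsSymm.dotProduct_mulVec_comm {P : Matrix (Fin n) (Fin n) ℝ} (hP : P.IsSymm)
    (x y : Fin n → ℝ) : x ⬝ᵥ P *ᵥ y = y ⬝ᵥ P *ᵥ x := by
  rw [Matrix.dotProduct_mulVec, ← Matrix.mulVec_transpose, hP.eq, dotProduct_comm]

theorem Matrix.PosSemidef.isSymm_real {P : Matrix (Fin n) (Fin n) ℝ} (hP : P.PosSemidef) :
    P.IsSymm := by
  have := hP.isHermitian
  rwa [Matrix.IsHermitian, Matrix.conjTranspose_eq_transpose_of_trivial] at this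

theorem Matrix.PosDef.isSymm_real {P : Matrix (Fin n) (Fin n) ℝ} (hP : P.PosDef) :
    P.IsSymm := hP.posSemidef.isSymm_real

theorem Matrix.PosSemidef.quad_nonneg {P : Matrix (Fin n) (Fin n) ℝ} (hP : P.PosSemidef)
    (x : Fin n → ℝ) : 0 ≤ x ⬝ᵥ P *ᵥ x := by
  simpa using hP.dotProduct_mulVec_nonneg x

theorem Matrix.PosDef.quad_pos {P : Matrix (Fin n) (Fin n) ℝ} (hP : P.PosDef)
    {x : Fin n → ℝ} (hx : x ≠ 0) : 0 < x ⬝ᵥ P *ᵥ x := by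
  simpa using hP.dotProduct_mulVec_pos hx

theorem posDef_of_quad_pos {P : Matrix (Fin n) (Fin n) ℝ} (hP : P.IsSymm)
    (h : ∀ x : Fin n → ℝ, x ≠ 0 → 0 < x ⬝ᵥ P *ᵥ x) : P.PosDef := by
  refine Matrix.PosDef.of_dotProduct_mulVec_pos ?_ fun x hx => by simpa using h x hx
  rwa [Matrix.IsHermitian, Matrix.conjTranspose_eq_transpose_of_trivial]

theorem posSemidef_of_quad_nonneg {P : Matrix (Fin n) (Fin n) ℝ} (hP : P.IsSymm)
    (h : ∀ x : Fin n → ℝ, 0 ≤ x ⬝ᵥ P *ᵥ x) : P.PosSemidef := by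
  refine Matrix.PosSemidef.of_dotProduct_mulVec_nonneg ?_ fun x => by simpa using h x
  rwa [Matrix.IsHermitian, Matrix.conjTranspose_eq_transpose_of_trivial]

theorem posDef_of_quad_le {P Q : Matrix (Fin n) (Fin n) ℝ} (hQ : Q.PosDef) (hP : P.IsSymm)
    (h : ∀ x : Fin n → ℝ, x ⬝ᵥ Q *ᵥ x ≤ x ⬝ᵥ P *ᵥ x) : P.PosDef :=
  posDef_of_quad_pos hP fun x hx => (hQ.quad_pos hx).trans_le (h x)

theorem quad_add_smul {P : Matrix (Fin n) (Fin n) ℝ} (hP : P.IsSymm) (v b : Fin n → ℝ) (k : ℝ) :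
    (v + k • b) ⬝ᵥ P *ᵥ (v + k • b) =
      v ⬝ᵥ P *ᵥ v + 2 * k * (b ⬝ᵥ P *ᵥ v) + k ^ 2 * (b ⬝ᵥ P *ᵥ b) := by
  simp only [Matrix.mulVec_add, Matrix.mulVec_smul, dotProduct_add, add_dotProduct,
    smul_dotProduct, dotProduct_smul, smul_eq_mul]
  rw [hP.dotProduct_mulVec_comm v b]
  ring

/-- Polarization: a symmetric matrix is determined by its quadratic form. -/
theorem apply_eq_polarization {P : Matrix (Fin n) (Fin n) ℝ} (hP : P.IsSymm) (i j : Fin n) :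
    P i j = ((Pi.single i 1 + Pi.single j 1) ⬝ᵥ P *ᵥ (Pi.single i 1 + Pi.single j 1) -
      Pi.single i 1 ⬝ᵥ P *ᵥ Pi.single i 1 - Pi.single j 1 ⬝ᵥ P *ᵥ Pi.single j 1) / 2 := by
  have h := hP.apply i j
  simp [Matrix.mulVec_add, add_dotProduct, dotProduct_add, Matrix.col_apply]
  linarith

theorem eq_of_quad_eq {P Q : Matrix (Fin n) (Fin n) ℝ} (hP : P.IsSymm) (hQ : Q.IsSymm)
    (h : ∀ x : Fin n → ℝ, x ⬝ᵥ P *ᵥ x = x ⬝ᵥ Q *ᵥ x) : P = Q := by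
  ext i j
  rw [apply_eq_polarization hP, apply_eq_polarization hQ, h, h, h]

theorem continuous_quad (P : Matrix (Fin n) (Fin n) ℝ) :
    Continuous fun x : Fin n → ℝ => x ⬝ᵥ P *ᵥ x := by
  fun_prop

theorem quad_smul (P : Matrix (Fin n) (Fin n) ℝ) (c : ℝ) (x : Fin n → ℝ) :
    (c • x) ⬝ᵥ P *ᵥ (c • x) = c ^ 2 * (x ⬝ᵥ P *ᵥ x) := by
  simp only [Matrix.mulVec_smul, smul_dotProduct, dotProduct_smul, smul_eq_mul]
  ring

/-- The quotient of the two forms is continuous on the compact unit sphere, hence bounded there;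
homogeneity does the rest. -/
theorem exists_quad_le_mul (P : Matrix (Fin n) (Fin n) ℝ) {Q : Matrix (Fin n) (Fin n) ℝ}
    (hQ : Q.PosDef) : ∃ C : ℝ, 0 < C ∧ ∀ x : Fin n → ℝ, x ⬝ᵥ P *ᵥ x ≤ C * (x ⬝ᵥ Q *ᵥ x) := by
  have hne : ∀ x ∈ Metric.sphere (0 : Fin n → ℝ) 1, x ≠ 0 := fun x hx h => by
    simp [h] at hx
  have hc : ContinuousOn (fun x : Fin n → ℝ => (x ⬝ᵥ P *ᵥ x) / (x ⬝ᵥ Q *ᵥ x))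
      (Metric.sphere 0 1) :=
    (continuous_quad P).continuousOn.div (continuous_quad Q).continuousOn
      fun x hx => (hQ.quad_pos (hne x hx)).ne'
  obtain ⟨C, hC⟩ := (isCompact_sphere (0 : Fin n → ℝ) 1).bddAbove_image hc
  refine ⟨max C 1, by positivity, fun x => ?_⟩
  by_cases hx : x = 0
  · simp [hx]
  have hx' : ‖x‖ ≠ 0 := norm_ne_zero_iff.mpr hx
  have hs : ‖x‖⁻¹ • x ∈ Metric.sphere (0 : Fin n → ℝ) 1 := by
    simp [norm_smul, hx']
  have h1 := hC ⟨_, hs, rfl⟩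
  simp only at h1
  rw [div_le_iff₀ (hQ.quad_pos (hne _ hs)), quad_smul, quad_smul] at h1
  have h2 : x ⬝ᵥ P *ᵥ x ≤ C * (x ⬝ᵥ Q *ᵥ x) := by
    have h3 : 0 < ‖x‖⁻¹ ^ 2 := by positivity
    nlinarith
  exact h2.trans (mul_le_mul_of_nonneg_right (le_max_left _ _) (hQ.quad_pos hx).le)

/-- Cauchy–Schwarz for the form of a positive semidefinite matrix. -/
theorem Matrix.PosSemidef.quad_sq_le {P : Matrix (Fin n) (Fin n) ℝ} (hP : P.PosSemidef)
    (b v : Fin n → ℝ) : (b ⬝ᵥ P *ᵥ v) ^ 2 ≤ (b ⬝ᵥ P *ᵥ b) * (v ⬝ᵥ P *ᵥ v) := by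
  have h : ∀ k : ℝ, 0 ≤ (b ⬝ᵥ P *ᵥ b) * (k * k) + 2 * (b ⬝ᵥ P *ᵥ v) * k + v ⬝ᵥ P *ᵥ v := by
    intro k
    have := hP.quad_nonneg (v + k • b)
    rw [quad_add_smul hP.isSymm_real] at this
    linarith
  have := discrim_le_zero h
  rw [discrim] at this
  linarith

end QuadraticForms

/-! ### The Riccati map: monotonicity, existence and uniqueness of fixed points -/

section Riccati

variable {n : ℕ}

/-- The Riccati map `P ↦ AᵀPA - γ AᵀPb (r + bᵀPb)⁻¹ bᵀPA + Q` for a single input `b`. -/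
noncomputable def riccatiMap (A : Matrix (Fin n) (Fin n) ℝ) (b : Fin n → ℝ) (γ r : ℝ)
    (Q P : Matrix (Fin n) (Fin n) ℝ) : Matrix (Fin n) (Fin n) ℝ :=
  Aᵀ * P * A - (γ / (r + b ⬝ᵥ P *ᵥ b)) •
    Matrix.vecMulVec (Aᵀ *ᵥ (P *ᵥ b)) (Aᵀ *ᵥ (P *ᵥ b)) + Q

variable {A : Matrix (Fin n) (Fin n) ℝ} {b : Fin n → ℝ} {γ r : ℝ} {P Q S : Matrix (Fin n) (Fin n) ℝ}

theorem transpose_mulVec_mulVec_dotProduct (hP : P.IsSymm) (x : Fin n → ℝ) :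
    x ⬝ᵥ (Aᵀ *ᵥ (P *ᵥ b)) = b ⬝ᵥ P *ᵥ (A *ᵥ x) := by
  rw [Matrix.dotProduct_mulVec, Matrix.vecMul_transpose, hP.dotProduct_mulVec_comm]

theorem quad_conj (x : Fin n → ℝ) :
    x ⬝ᵥ (Aᵀ * P * A) *ᵥ x = (A *ᵥ x) ⬝ᵥ P *ᵥ (A *ᵥ x) := by
  rw [← Matrix.mulVec_mulVec, ← Matrix.mulVec_mulVec, Matrix.dotProduct_mulVec,
    Matrix.vecMul_transpose]

theorem quad_riccatiMap (hP : P.IsSymm) (x : Fin n → ℝ) :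
    x ⬝ᵥ riccatiMap A b γ r Q P *ᵥ x = (A *ᵥ x) ⬝ᵥ P *ᵥ (A *ᵥ x) -
      γ / (r + b ⬝ᵥ P *ᵥ b) * (b ⬝ᵥ P *ᵥ (A *ᵥ x)) ^ 2 + x ⬝ᵥ Q *ᵥ x := by
  rw [riccatiMap, Matrix.add_mulVec, Matrix.sub_mulVec, dotProduct_add, dotProduct_sub, quad_conj,
    Matrix.smul_mulVec, dotProduct_smul, Matrix.vecMulVec_mulVec, smul_eq_mul]
  congr 2
  simp only [dotProduct_smul, MulOpposite.smul_eq_mul_unop, MulOpposite.unop_op]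
  rw [dotProduct_comm _ x, transpose_mulVec_mulVec_dotProduct hP]
  ring

theorem isSymm_riccatiMap (hQ : Q.IsSymm) (hP : P.IsSymm) : (riccatiMap A b γ r Q P).IsSymm := by
  rw [riccatiMap]
  refine Matrix.IsSymm.add (Matrix.IsSymm.sub ?_ (Matrix.IsSymm.smul ?_ _)) hQ
  · rw [Matrix.IsSymm, Matrix.transpose_mul, Matrix.transpose_mul, Matrix.transpose_transpose,
      hP.eq, Matrix.mul_assoc]
  · rw [Matrix.IsSymm, Matrix.transpose_vecMulVec]

/-- The Riccati map is the lower envelope of the affine maps given by the feedback values `k`. -/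
theorem quad_riccatiMap_le (hγ : 0 ≤ γ) (hr : 0 ≤ r) (hP : P.PosSemidef) (x : Fin n → ℝ) (k : ℝ) :
    x ⬝ᵥ riccatiMap A b γ r Q P *ᵥ x ≤ (1 - γ) * ((A *ᵥ x) ⬝ᵥ P *ᵥ (A *ᵥ x)) +
      γ * ((A *ᵥ x + k • b) ⬝ᵥ P *ᵥ (A *ᵥ x + k • b) + r * k ^ 2) + x ⬝ᵥ Q *ᵥ x := by
  rw [quad_riccatiMap hP.isSymm_real, quad_add_smul hP.isSymm_real]
  set s := b ⬝ᵥ P *ᵥ (A *ᵥ x)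
  have hcs := hP.quad_sq_le b (A *ᵥ x)
  have hβ := hP.quad_nonneg b
  set β := b ⬝ᵥ P *ᵥ b
  -- A vanishing denominator forces `s = 0` by Cauchy–Schwarz; otherwise the gap between the two
  -- sides is the completed square below.
  rcases (add_nonneg hr hβ).eq_or_lt with h | h
  · have hβ0 : β = 0 := by linarith
    have hs : s = 0 := by
      rw [hβ0, zero_mul] at hcs
      exact pow_eq_zero_iff two_ne_zero |>.mp (le_antisymm hcs (sq_nonneg _))
    have hr0 : r = 0 := by linarith
    rw [hs, hβ0, hr0]
    simp
    linarith
  · have h1 : 0 ≤ γ / (r + β) * ((r + β) * k + s) ^ 2 := by positivity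
    have h2 : γ / (r + β) * ((r + β) * k + s) ^ 2 =
        γ * (2 * k * s + k ^ 2 * β + r * k ^ 2) + γ / (r + β) * s ^ 2 := by
      field_simp
      ring
    linarith

/-- The envelope is attained at the minimizing feedback value `k = -s / (r + β)`, where `s = bᵀPAx`
and `β = bᵀPb`; for `r + β = 0` the convention `t / 0 = 0` gives `k = 0`. -/
theorem quad_riccatiMap_eq (hr : 0 ≤ r) (hP : P.PosSemidef) (x : Fin n → ℝ) :
    x ⬝ᵥ riccatiMap A b γ r Q P *ᵥ x = (1 - γ) * ((A *ᵥ x) ⬝ᵥ P *ᵥ (A *ᵥ x)) +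
      γ * ((A *ᵥ x + (-(b ⬝ᵥ P *ᵥ (A *ᵥ x)) / (r + b ⬝ᵥ P *ᵥ b)) • b) ⬝ᵥ P *ᵥ
        (A *ᵥ x + (-(b ⬝ᵥ P *ᵥ (A *ᵥ x)) / (r + b ⬝ᵥ P *ᵥ b)) • b) +
          r * (-(b ⬝ᵥ P *ᵥ (A *ᵥ x)) / (r + b ⬝ᵥ P *ᵥ b)) ^ 2) + x ⬝ᵥ Q *ᵥ x := by
  rw [quad_riccatiMap hP.isSymm_real, quad_add_smul hP.isSymm_real]
  set s := b ⬝ᵥ P *ᵥ (A *ᵥ x)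
  have hβ := hP.quad_nonneg b
  set β := b ⬝ᵥ P *ᵥ b
  rcases (add_nonneg hr hβ).eq_or_lt with h | h
  · rw [← h]
    simp
    linarith
  · field_simp
    ring

/-- Use the feedback optimal for `S` as a competitor for `P`: for a fixed feedback the cost is
monotone in the matrix. -/
theorem riccatiMap_mono (hγ : 0 ≤ γ) (hγ1 : γ ≤ 1) (hr : 0 ≤ r) (hP : P.PosSemidef)
    (hS : S.PosSemidef) (h : ∀ x : Fin n → ℝ, x ⬝ᵥ P *ᵥ x ≤ x ⬝ᵥ S *ᵥ x) (x : Fin n → ℝ) :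
    x ⬝ᵥ riccatiMap A b γ r Q P *ᵥ x ≤ x ⬝ᵥ riccatiMap A b γ r Q S *ᵥ x := by
  rw [quad_riccatiMap_eq hr hS x]
  refine (quad_riccatiMap_le hγ hr hP x
    (-(b ⬝ᵥ S *ᵥ (A *ᵥ x)) / (r + b ⬝ᵥ S *ᵥ b))).trans ?_
  have hγ' : 0 ≤ 1 - γ := by linarith
  gcongr
  all_goals exact h _

theorem quad_le_riccatiMap (hγ : 0 ≤ γ) (hγ1 : γ ≤ 1) (hr : 0 ≤ r) (hP : P.PosSemidef)
    (x : Fin n → ℝ) : x ⬝ᵥ Q *ᵥ x ≤ x ⬝ᵥ riccatiMap A b γ r Q P *ᵥ x := by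
  rw [quad_riccatiMap_eq hr hP x]
  set v := A *ᵥ x + (-(b ⬝ᵥ P *ᵥ (A *ᵥ x)) / (r + b ⬝ᵥ P *ᵥ b)) • b
  have h1 := hP.quad_nonneg (A *ᵥ x)
  have h2 := hP.quad_nonneg v
  have h3 : 0 ≤ (1 - γ) * ((A *ᵥ x) ⬝ᵥ P *ᵥ (A *ᵥ x)) := mul_nonneg (by linarith) h1
  have h4 : 0 ≤ γ * (v ⬝ᵥ P *ᵥ v + r * (-(b ⬝ᵥ P *ᵥ (A *ᵥ x)) / (r + b ⬝ᵥ P *ᵥ b)) ^ 2) := by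
    positivity
  linarith

/-- A monotone sequence of symmetric matrices bounded above converges. -/
theorem exists_tendsto_of_quad_monotone {R : ℕ → Matrix (Fin n) (Fin n) ℝ}
    (hR : ∀ k, (R k).IsSymm) (hmono : ∀ k x, x ⬝ᵥ R k *ᵥ x ≤ x ⬝ᵥ R (k + 1) *ᵥ x)
    (hle : ∀ k x, x ⬝ᵥ R k *ᵥ x ≤ x ⬝ᵥ S *ᵥ x) :
    ∃ P, Tendsto R atTop (𝓝 P) := by
  have hq : ∀ x : Fin n → ℝ, ∃ l, Tendsto (fun k => x ⬝ᵥ R k *ᵥ x) atTop (𝓝 l) := fun x =>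
    ⟨_, tendsto_atTop_ciSup (monotone_nat_of_le_succ fun k => hmono k x)
      ⟨x ⬝ᵥ S *ᵥ x, by rintro _ ⟨k, rfl⟩; exact hle k x⟩⟩
  choose l hl using hq
  refine ⟨Matrix.of fun i j => (l (Pi.single i 1 + Pi.single j 1) - l (Pi.single i 1) -
    l (Pi.single j 1)) / 2, ?_⟩
  refine tendsto_pi_nhds.mpr fun i => tendsto_pi_nhds.mpr fun j => ?_
  simp_rw [apply_eq_polarization (hR _) i j]
  exact (((hl _).sub (hl _)).sub (hl _)).div_const 2

theorem isClosed_isSymm : IsClosed {P : Matrix (Fin n) (Fin n) ℝ | P.IsSymm} :=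
  isClosed_eq (by fun_prop) continuous_id

/-- The only possible discontinuity is the denominator; where it vanishes the hypothesis gives `b =
0`, and the map is then affine. The state cost varies too, so that `ε → 0` is covered. -/
theorem tendsto_riccatiMap {ι : Type*} {l : Filter ι} {R Q' : ι → Matrix (Fin n) (Fin n) ℝ}
    (h : r + b ⬝ᵥ P *ᵥ b = 0 → b = 0) (hR : Tendsto R l (𝓝 P)) (hQ : Tendsto Q' l (𝓝 Q)) :
    Tendsto (fun i => riccatiMap A b γ r (Q' i) (R i)) l (𝓝 (riccatiMap A b γ r Q P)) := by
  by_cases hb : b = 0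
  · have h1 : ∀ T U, riccatiMap A b γ r T U = Aᵀ * U * A + T := by
      intro T U
      simp [riccatiMap, hb, Matrix.vecMulVec]
      ext i j
      simp
    simp_rw [h1]
    exact ((tendsto_const_nhds.mul hR).mul tendsto_const_nhds).add hQ
  · have h1 : r + b ⬝ᵥ P *ᵥ b ≠ 0 := fun h' => hb (h h')
    have h2 : Continuous fun U : Matrix (Fin n) (Fin n) ℝ => r + b ⬝ᵥ U *ᵥ b := by fun_prop
    have h3 : Continuous fun U : Matrix (Fin n) (Fin n) ℝ =>
      Matrix.vecMulVec (Aᵀ *ᵥ (U *ᵥ b)) (Aᵀ *ᵥ (U *ᵥ b)) := by fun_prop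
    have h4 := (tendsto_const_nhds (x := γ)).div ((h2.tendsto P).comp hR) h1
    exact (((tendsto_const_nhds.mul hR).mul tendsto_const_nhds).sub
      (h4.smul ((h3.tendsto P).comp hR))).add hQ

theorem tendsto_quad {ι : Type*} {l : Filter ι} {R : ι → Matrix (Fin n) (Fin n) ℝ}
    (hR : Tendsto R l (𝓝 P)) (x : Fin n → ℝ) :
    Tendsto (fun i => x ⬝ᵥ R i *ᵥ x) l (𝓝 (x ⬝ᵥ P *ᵥ x)) := by
  have h2 : Continuous fun U : Matrix (Fin n) (Fin n) ℝ => x ⬝ᵥ U *ᵥ x := by fun_prop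
  exact (h2.tendsto P).comp hR

/-- A supersolution of the Riccati equation dominates a positive definite solution. -/
theorem exists_riccati_solution (hγ : 0 ≤ γ) (hγ1 : γ ≤ 1) (hr : 0 ≤ r) (hQ : Q.PosDef)
    (hS : S.PosSemidef)
    (hsup : ∀ x : Fin n → ℝ, x ⬝ᵥ riccatiMap A b γ r Q S *ᵥ x ≤ x ⬝ᵥ S *ᵥ x) :
    ∃ P : Matrix (Fin n) (Fin n) ℝ, P.PosDef ∧ P = riccatiMap A b γ r Q P ∧
      ∀ x : Fin n → ℝ, x ⬝ᵥ P *ᵥ x ≤ x ⬝ᵥ S *ᵥ x := by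
  -- `Q` lies below its own image, so the iterates increase; they also stay above `Q`, which keeps
  -- the limit positive definite.
  let R : ℕ → Matrix (Fin n) (Fin n) ℝ := fun k => (riccatiMap A b γ r Q)^[k] Q
  have hR : ∀ k, R (k + 1) = riccatiMap A b γ r Q (R k) := fun k =>
    Function.iterate_succ_apply' _ _ _
  have hpd : ∀ k, (R k).PosDef ∧ ∀ x, x ⬝ᵥ Q *ᵥ x ≤ x ⬝ᵥ R k *ᵥ x := by
    intro k
    induction k with
    | zero => exact ⟨hQ, fun x => le_rfl⟩
    | succ k ih =>
      rw [hR]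
      have h1 := quad_le_riccatiMap (A := A) (b := b) (Q := Q) hγ hγ1 hr ih.1.posSemidef
      exact ⟨posDef_of_quad_le hQ (isSymm_riccatiMap hQ.isSymm_real ih.1.isSymm_real) h1, h1⟩
  have hmono : ∀ k x, x ⬝ᵥ R k *ᵥ x ≤ x ⬝ᵥ R (k + 1) *ᵥ x := by
    intro k
    induction k with
    | zero => exact (hpd 1).2
    | succ k ih =>
      intro x
      rw [hR (k + 1)]
      nth_rewrite 1 [hR k]
      exact riccatiMap_mono hγ hγ1 hr (hpd _).1.posSemidef (hpd _).1.posSemidef ih x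
  have hle : ∀ k x, x ⬝ᵥ R k *ᵥ x ≤ x ⬝ᵥ S *ᵥ x := by
    intro k
    induction k with
    | zero => exact fun x => (quad_le_riccatiMap hγ hγ1 hr hS x).trans (hsup x)
    | succ k ih =>
      intro x
      rw [hR k]
      exact (riccatiMap_mono hγ hγ1 hr (hpd _).1.posSemidef hS ih x).trans (hsup x)
  obtain ⟨P, hP⟩ := exists_tendsto_of_quad_monotone (fun k => (hpd k).1.isSymm_real) hmono hle
  have hPs : P.IsSymm := isClosed_isSymm.mem_of_tendsto hP
    (Eventually.of_forall fun k => (hpd k).1.isSymm_real)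
  have hPd : P.PosDef := posDef_of_quad_le hQ hPs fun x =>
    ge_of_tendsto' (tendsto_quad hP x) fun k => (hpd k).2 x
  refine ⟨P, hPd, ?_, fun x => le_of_tendsto' (tendsto_quad hP x) fun k => hle k x⟩
  have h1 : Tendsto (fun k => R (k + 1)) atTop (𝓝 P) := hP.comp (tendsto_add_atTop_nat 1)
  refine tendsto_nhds_unique h1 ?_
  simp_rw [hR]
  refine tendsto_riccatiMap (fun h => ?_) hP tendsto_const_nhds
  by_contra hb
  have := hPd.quad_pos hb
  linarith

/-- Two positive definite solutions of the Riccati equation are comparable both ways. -/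
theorem riccati_solution_le (hγ : 0 ≤ γ) (hγ1 : γ ≤ 1) (hr : 0 ≤ r) (hQ : Q.PosDef)
    (hP : P.PosDef) (hPe : P = riccatiMap A b γ r Q P) (hS : S.PosDef)
    (hSe : S = riccatiMap A b γ r Q S) (x : Fin n → ℝ) : x ⬝ᵥ P *ᵥ x ≤ x ⬝ᵥ S *ᵥ x := by
  obtain ⟨C, hC0, hC⟩ := exists_quad_le_mul P hS
  obtain ⟨D, hD0, hD⟩ := exists_quad_le_mul S hQ
  -- `Q ≤ S ≤ D Q` forces `D ≥ 1` as soon as there is a nonzero vector; this makes `ρ = 1 - D⁻¹`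
  -- nonnegative.
  have hD1 : 1 ≤ D ∨ n = 0 := by
    by_cases hn : n = 0
    · exact Or.inr hn
    · left
      have : NeZero n := ⟨hn⟩
      have hne : (Pi.single 0 1 : Fin n → ℝ) ≠ 0 := by simp
      have h1 := hD (Pi.single 0 1)
      have h2 := hQ.quad_pos hne
      have h3 := quad_le_riccatiMap (A := A) (b := b) (Q := Q) hγ hγ1 hr hS.posSemidef
        (Pi.single 0 1)
      rw [← hSe] at h3
      by_contra! hlt
      nlinarith
  rcases hD1 with hD1 | hn
  swap
  · subst hn
    simp [Subsingleton.elim x 0]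
  set ρ := 1 - D⁻¹ with hρ
  have hDi : D⁻¹ ≤ 1 := inv_le_one_of_one_le₀ hD1
  have hDi0 : 0 < D⁻¹ := by positivity
  -- Contraction: if `P - S ≤ c S`, the feedback optimal for `S` bounds the new excess by `c` times
  -- the `S`-cost of one step. That cost is at most `S - Q`, and `Q ≥ D⁻¹ S`.
  have hstep : ∀ c : ℝ, 0 ≤ c → (∀ x, x ⬝ᵥ P *ᵥ x - x ⬝ᵥ S *ᵥ x ≤ c * (x ⬝ᵥ S *ᵥ x)) →
      ∀ x, x ⬝ᵥ P *ᵥ x - x ⬝ᵥ S *ᵥ x ≤ (ρ * c) * (x ⬝ᵥ S *ᵥ x) := by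
    intro c hc h x
    set k := -(b ⬝ᵥ S *ᵥ (A *ᵥ x)) / (r + b ⬝ᵥ S *ᵥ b) with hk
    have h1 := quad_riccatiMap_le (A := A) (b := b) (Q := Q) hγ hr hP.posSemidef x k
    have h2 := quad_riccatiMap_eq (A := A) (b := b) (γ := γ) (Q := Q) hr hS.posSemidef x
    rw [← hPe] at h1
    rw [← hSe, ← hk] at h2
    have h3 := h (A *ᵥ x)
    have h4 := h (A *ᵥ x + k • b)
    have h5 := hD x
    have h6 : D⁻¹ * (x ⬝ᵥ S *ᵥ x) ≤ x ⬝ᵥ Q *ᵥ x := by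
      rw [inv_mul_le_iff₀ hD0]; exact h5
    set u := (A *ᵥ x) ⬝ᵥ S *ᵥ (A *ᵥ x)
    set u' := (A *ᵥ x) ⬝ᵥ P *ᵥ (A *ᵥ x)
    set v := (A *ᵥ x + k • b) ⬝ᵥ S *ᵥ (A *ᵥ x + k • b)
    set v' := (A *ᵥ x + k • b) ⬝ᵥ P *ᵥ (A *ᵥ x + k • b)
    have h7 : (1 - γ) * (u' - u) ≤ (1 - γ) * (c * u) :=
      mul_le_mul_of_nonneg_left h3 (by linarith)
    have h8 : γ * (v' - v) ≤ γ * (c * v) := mul_le_mul_of_nonneg_left h4 hγ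
    have h9 : c * ((1 - γ) * u + γ * v) ≤ c * (ρ * (x ⬝ᵥ S *ᵥ x)) := by
      apply mul_le_mul_of_nonneg_left _ hc
      have h10 : 0 ≤ γ * (r * k ^ 2) := by positivity
      rw [hρ]
      linarith
    linarith
  have hpow : ∀ m : ℕ, ∀ x, x ⬝ᵥ P *ᵥ x - x ⬝ᵥ S *ᵥ x ≤ (ρ ^ m * C) * (x ⬝ᵥ S *ᵥ x) := by
    intro m
    induction m with
    | zero =>
      intro x
      have := hC x
      have := hS.posSemidef.quad_nonneg x
      simp only [pow_zero, one_mul]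
      linarith
    | succ m ih =>
      have h1 : 0 ≤ ρ := by linarith
      have := hstep _ (by positivity) ih
      intro x
      rw [pow_succ', mul_assoc ρ]
      exact this x
  have hlim : Tendsto (fun m : ℕ => (ρ ^ m * C) * (x ⬝ᵥ S *ᵥ x)) atTop (𝓝 0) := by
    have := tendsto_pow_atTop_nhds_zero_of_lt_one (show 0 ≤ ρ by linarith)
      (show ρ < 1 by linarith)
    simpa using (this.mul_const C).mul_const (x ⬝ᵥ S *ᵥ x)
  have := ge_of_tendsto' hlim fun m => hpow m x
  linarith

end Riccati

/-! ### Schur stability and Lyapunov functions -/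

section SchurStable

variable {n : ℕ}

open scoped ENNReal NNReal in
-- Gelfand's formula over `ℂ` gives geometric decay of the norms of the powers; real parts bring the
-- limit back to `ℝ`.
theorem IsSchurStable.tendsto_pow {A : Matrix (Fin n) (Fin n) ℝ} (hA : IsSchurStable A) :
    Tendsto (fun k : ℕ => A ^ k) atTop (𝓝 0) := by
  rcases Nat.eq_zero_or_pos n with hn | hn
  · subst hn
    exact tendsto_const_nhds.congr fun k => Subsingleton.elim _ _
  have : Nonempty (Fin n) := ⟨⟨0, hn⟩⟩
  let _ : NormedRing (Matrix (Fin n) (Fin n) ℂ) := Matrix.linftyOpNormedRing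
  let _ : NormedAlgebra ℂ (Matrix (Fin n) (Fin n) ℂ) := Matrix.linftyOpNormedAlgebra
  have : CompleteSpace (Matrix (Fin n) (Fin n) ℂ) := FiniteDimensional.complete ℂ _
  set a := A.map (algebraMap ℝ ℂ) with ha
  have hr : spectralRadius ℂ a < (1 : ℝ≥0) :=
    spectrum.spectralRadius_lt_of_forall_lt a fun z hz => by exact_mod_cast hA z hz
  obtain ⟨ρ, hρ1, hρ2⟩ := ENNReal.lt_iff_exists_nnreal_btwn.mp hr
  have hev := (spectrum.pow_nnnorm_pow_one_div_tendsto_nhds_spectralRadius a).eventually_lt_const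
    hρ1
  have hle : ∀ᶠ k : ℕ in atTop, ‖a ^ k‖ ≤ (ρ : ℝ) ^ k := by
    filter_upwards [hev, eventually_gt_atTop 0] with k hk hk0
    have hk' : (0 : ℝ) < k := by exact_mod_cast hk0
    have h1 : ((‖a ^ k‖₊ : ℝ≥0∞) ^ (1 / k : ℝ)) ^ (k : ℝ) ≤ (ρ : ℝ≥0∞) ^ (k : ℝ) :=
      ENNReal.rpow_le_rpow hk.le hk'.le
    rw [← ENNReal.rpow_mul, one_div_mul_cancel hk'.ne', ENNReal.rpow_one,
      ENNReal.rpow_natCast] at h1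
    exact_mod_cast h1
  have hpow : Tendsto (fun k : ℕ => (ρ : ℝ) ^ k) atTop (𝓝 0) :=
    tendsto_pow_atTop_nhds_zero_of_lt_one ρ.2 (by exact_mod_cast hρ2)
  have hz : Tendsto (fun k : ℕ => a ^ k) atTop (𝓝 0) :=
    squeeze_zero_norm' hle hpow
  have hre : Continuous fun M : Matrix (Fin n) (Fin n) ℂ => M.map Complex.re :=
    continuous_id.matrix_map Complex.continuous_re
  have := (hre.tendsto 0).comp hz
  have h0 : (0 : Matrix (Fin n) (Fin n) ℂ).map Complex.re = 0 := by ext; simp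
  rw [h0] at this
  refine this.congr fun k => ?_
  have : a ^ k = (A ^ k).map (algebraMap ℝ ℂ) := by
    rw [ha, ← RingHom.mapMatrix_apply, ← RingHom.mapMatrix_apply, map_pow]
  ext i j
  simp [this]

theorem dotProduct_mulVec_self_le (T : Matrix (Fin n) (Fin n) ℝ) (x : Fin n → ℝ) :
    (T *ᵥ x) ⬝ᵥ (T *ᵥ x) ≤ (∑ i, ∑ j, T i j ^ 2) * (x ⬝ᵥ x) := by
  rw [dotProduct, Finset.sum_mul]
  refine Finset.sum_le_sum fun i _ => ?_
  have := Finset.sum_mul_sq_le_sq_mul_sq Finset.univ (T i) x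
  simpa [Matrix.mulVec, dotProduct, ← pow_two] using this

/-- A Schur stable matrix has a quadratic Lyapunov function. -/
theorem IsSchurStable.exists_lyapunov {A : Matrix (Fin n) (Fin n) ℝ} (hA : IsSchurStable A) :
    ∃ S : Matrix (Fin n) (Fin n) ℝ, S.PosSemidef ∧
      ∀ x : Fin n → ℝ, (A *ᵥ x) ⬝ᵥ S *ᵥ (A *ᵥ x) ≤ x ⬝ᵥ S *ᵥ x - x ⬝ᵥ x := by
  have hF : Continuous fun T : Matrix (Fin n) (Fin n) ℝ => ∑ i, ∑ j, T i j ^ 2 := by fun_prop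
  have h0 := (hF.tendsto 0).comp hA.tendsto_pow
  simp only [Matrix.zero_apply, ne_eq, OfNat.ofNat_ne_zero, not_false_eq_true, zero_pow,
    Finset.sum_const_zero] at h0
  -- A finite sum replaces the Lyapunov series: with `S = 2 ∑_{j<m} (A^j)ᵀ A^j` the change along `A`
  -- telescopes to `2|A^m x|² - 2|x|²`, at most `-|x|²` once the squared Frobenius norm of `A^m` is
  -- below `1/2`.
  obtain ⟨m, hm⟩ := (h0.eventually_lt_const (show (0 : ℝ) < 1 / 2 by norm_num)).exists
  have hquad : ∀ x : Fin n → ℝ, x ⬝ᵥ ((2 : ℝ) • ∑ j ∈ Finset.range m, (A ^ j)ᵀ * A ^ j) *ᵥ x =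
      2 * ∑ j ∈ Finset.range m, (A ^ j *ᵥ x) ⬝ᵥ (A ^ j *ᵥ x) := by
    intro x
    rw [Matrix.smul_mulVec, dotProduct_smul, smul_eq_mul, Matrix.sum_mulVec, dotProduct_sum]
    congr 1
    refine Finset.sum_congr rfl fun j _ => ?_
    rw [← Matrix.mulVec_mulVec, Matrix.dotProduct_mulVec, Matrix.vecMul_transpose]
  have hself : ∀ y : Fin n → ℝ, 0 ≤ y ⬝ᵥ y := fun y =>
    Finset.sum_nonneg fun i _ => mul_self_nonneg _
  refine ⟨(2 : ℝ) • ∑ j ∈ Finset.range m, (A ^ j)ᵀ * A ^ j, ?_, fun x => ?_⟩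
  · refine posSemidef_of_quad_nonneg ?_ fun x => ?_
    · rw [Matrix.IsSymm, Matrix.transpose_smul, Matrix.transpose_sum]
      simp [Matrix.transpose_mul]
    · rw [hquad]
      exact mul_nonneg zero_le_two (Finset.sum_nonneg fun j _ => hself _)
  · rw [hquad, hquad]
    have h1 : ∀ j, A ^ j *ᵥ (A *ᵥ x) = A ^ (j + 1) *ᵥ x := fun j => by
      rw [Matrix.mulVec_mulVec, pow_succ]
    simp_rw [h1]
    have h2 := Finset.sum_range_succ (fun j => (A ^ j *ᵥ x) ⬝ᵥ (A ^ j *ᵥ x)) m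
    have h3 := Finset.sum_range_succ' (fun j => (A ^ j *ᵥ x) ⬝ᵥ (A ^ j *ᵥ x)) m
    have h4 := dotProduct_mulVec_self_le (A ^ m) x
    have h5 : (∑ i, ∑ j, (A ^ m) i j ^ 2) * (x ⬝ᵥ x) ≤ 1 / 2 * (x ⬝ᵥ x) :=
      mul_le_mul_of_nonneg_right hm.le (hself x)
    simp only [pow_zero, Matrix.one_mulVec] at h3
    linarith

end SchurStable

/-! ### Determinants and the Mahler measure bound -/

section MahlerBound

/-- Factoring out the diagonal matrix `D` leaves `1 - c b (Db)ᵀ`, to which the matrix determinant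
lemma applies; `D` need not be invertible. -/
theorem det_diagonal_sub_vecMulVec {m : Type*} [Fintype m] [DecidableEq m] (d b : m → ℝ) (c : ℝ) :
    (Matrix.diagonal d - c • Matrix.vecMulVec (Matrix.diagonal d *ᵥ b)
      (Matrix.diagonal d *ᵥ b)).det =
    (Matrix.diagonal d).det * (1 - c * (b ⬝ᵥ Matrix.diagonal d *ᵥ b)) := by
  have h : Matrix.diagonal d - c • Matrix.vecMulVec (Matrix.diagonal d *ᵥ b)
      (Matrix.diagonal d *ᵥ b) = Matrix.diagonal d *
      (1 + Matrix.replicateCol Unit (-(c • b)) *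
        Matrix.replicateRow Unit (Matrix.diagonal d *ᵥ b)) := by
    ext i j
    simp only [Matrix.sub_apply, Matrix.smul_apply, Matrix.vecMulVec_apply, Matrix.mulVec_diagonal,
      Matrix.diagonal_mul, Matrix.add_apply]
    simp only [Matrix.mul_apply, Matrix.replicateCol_apply, Matrix.replicateRow_apply,
      Matrix.mulVec_diagonal, Finset.univ_unique, Finset.sum_singleton, Matrix.one_apply,
      Matrix.diagonal_apply, Pi.neg_apply, Pi.smul_apply, smul_eq_mul]
    split_ifs <;> ring
  rw [h, Matrix.det_mul, Matrix.det_one_add_replicateCol_mul_replicateRow, dotProduct_neg,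
    dotProduct_smul, dotProduct_comm, smul_eq_mul, sub_eq_add_neg]

theorem charpoly_eq_mul_of_blockTriangular {m R : Type*} [Fintype m] [DecidableEq m] [CommRing R]
    (M : Matrix m m R) (p : m → Prop) [DecidablePred p]
    (h : ∀ i, ¬p i → ∀ j, p j → M i j = 0) :
    M.charpoly = (M.toSquareBlockProp p).charpoly *
      (M.toSquareBlockProp fun i => ¬p i).charpoly := by
  rw [Matrix.charpoly, Matrix.twoBlockTriangular_det _ p fun i hi j hj => by
    have hij : i ≠ j := by rintro rfl; exact hi hj
    rw [Matrix.charmatrix_apply_ne _ _ _ hij, h i hi j hj, map_zero, neg_zero]]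
  have hb : ∀ (q : m → Prop) [DecidablePred q], (M.charmatrix).toSquareBlockProp q =
      (M.toSquareBlockProp q).charmatrix := by
    intro q _
    ext i j : 2
    simp [Matrix.charmatrix_apply, Matrix.toSquareBlockProp_def, Matrix.diagonal_apply,
      Subtype.ext_iff]
  rw [hb, hb, Matrix.charpoly, Matrix.charpoly]

theorem matrixMahlerMeasure_eq {n : ℕ} (A : Matrix (Fin n) (Fin n) ℝ) :
    matrixMahlerMeasure A =
      ((A.charpoly.map (algebraMap ℝ ℂ)).roots.map fun z => max 1 ‖z‖).prod := by
  rw [matrixMahlerMeasure, Matrix.charpoly_map]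

theorem one_le_prod_max_one_norm (s : Multiset ℂ) : 1 ≤ (s.map fun z => max 1 ‖z‖).prod := by
  induction s using Multiset.induction_on with
  | empty => simp
  | cons a s ih =>
    rw [Multiset.map_cons, Multiset.prod_cons]
    exact one_le_mul_of_one_le_of_one_le (le_max_left _ _) ih

theorem norm_prod_le_prod_max_one_norm (s : Multiset ℂ) :
    ‖s.prod‖ ≤ (s.map fun z => max 1 ‖z‖).prod := by
  induction s using Multiset.induction_on with
  | empty => simp
  | cons a s ih =>
    rw [Multiset.map_cons, Multiset.prod_cons, Multiset.prod_cons, norm_mul]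
    exact mul_le_mul (le_max_right _ _) ih (norm_nonneg _) (by positivity)

theorem one_le_matrixMahlerMeasure {n : ℕ} (A : Matrix (Fin n) (Fin n) ℝ) :
    1 ≤ matrixMahlerMeasure A := one_le_prod_max_one_norm _

/-- The determinant of a diagonal block of a block triangular matrix is bounded by the Mahler
measure of the whole matrix. -/
theorem abs_det_toSquareBlockProp_le {n : ℕ} (A : Matrix (Fin n) (Fin n) ℝ) (p : Fin n → Prop)
    [DecidablePred p] (h : ∀ i, ¬p i → ∀ j, p j → A i j = 0) :
    |(A.toSquareBlockProp fun i => ¬p i).det| ≤ matrixMahlerMeasure A := by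
  have h1 := charpoly_eq_mul_of_blockTriangular A p h
  set A₁ := A.toSquareBlockProp fun i => ¬p i
  set A₀ := A.toSquareBlockProp p
  have h0 : (A₀.charpoly.map (algebraMap ℝ ℂ)) * (A₁.charpoly.map (algebraMap ℝ ℂ)) ≠ 0 :=
    mul_ne_zero ((A₀.charpoly_monic.map _).ne_zero) ((A₁.charpoly_monic.map _).ne_zero)
  rw [matrixMahlerMeasure_eq, h1, Polynomial.map_mul, Polynomial.roots_mul h0, Multiset.map_add,
    Multiset.prod_add]
  have h2 : (A₁.map (algebraMap ℝ ℂ)).det = (A₁.charpoly.map (algebraMap ℝ ℂ)).roots.prod := by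
    rw [Matrix.det_eq_prod_roots_charpoly, Matrix.charpoly_map]
  have h3 : |A₁.det| = ‖(A₁.map (algebraMap ℝ ℂ)).det‖ := by
    rw [← RingHom.mapMatrix_apply, ← RingHom.map_det]
    simp
  rw [h3, h2]
  refine (norm_prod_le_prod_max_one_norm _).trans ?_
  exact le_mul_of_one_le_left (zero_le_one.trans (one_le_prod_max_one_norm _))
    (one_le_prod_max_one_norm _)

variable {n : ℕ}

/-- The equation reads `D = Aᵀ E A` with `E` a rank-one modification of `D`. The kernel of `D` is
`A`-invariant; on the complementary block `D` is invertible, and determinants give `1 + β =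
det(A₁)²`. -/
theorem diagonal_riccati_bound {A : Matrix (Fin n) (Fin n) ℝ} {b d : Fin n → ℝ} (hd : ∀ i, 0 ≤ d i)
    (h : Matrix.diagonal d = riccatiMap A b 1 1 0 (Matrix.diagonal d)) :
    1 + b ⬝ᵥ Matrix.diagonal d *ᵥ b ≤ matrixMahlerMeasure A ^ 2 := by
  classical
  set D := Matrix.diagonal d with hD
  have hDp : D.PosSemidef := Matrix.posSemidef_diagonal_iff.mpr hd
  have hβ := hDp.quad_nonneg b
  set β := b ⬝ᵥ D *ᵥ b with hβd
  set E := D - (1 / (1 + β)) • Matrix.vecMulVec (D *ᵥ b) (D *ᵥ b) with hE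
  have hDE : D = Aᵀ * E * A := by
    conv_lhs => rw [h]
    rw [riccatiMap, hE, add_zero, Matrix.mul_sub, Matrix.sub_mul, Matrix.mul_smul, Matrix.smul_mul,
      Matrix.mul_vecMulVec, Matrix.vecMulVec_mul, ← Matrix.mulVec_transpose]
  -- Tested on a kernel vector `e_j`, the equation gives `v = s² / (1 + β)` for `v = (A e_j)ᵀ D (A
  -- e_j)`, while Cauchy–Schwarz gives `s² ≤ β v`; hence `v = 0`.
  have hker : ∀ i, ¬ d i = 0 → ∀ j, d j = 0 → A i j = 0 := by
    intro i hi j hj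
    have h1 := quad_riccatiMap (A := A) (b := b) (γ := 1) (r := 1) (Q := 0) hDp.isSymm_real
      (Pi.single j 1)
    rw [← h] at h1
    have hjj : (Pi.single j 1 : Fin n → ℝ) ⬝ᵥ D *ᵥ Pi.single j 1 = 0 := by
      simp [hD, hj]
    have h2 := hDp.quad_sq_le b (A *ᵥ Pi.single j 1)
    rw [hjj, Matrix.zero_mulVec, dotProduct_zero, add_zero] at h1
    have h4 := hDp.quad_nonneg (A *ᵥ Pi.single j 1)
    have h3 : (A *ᵥ Pi.single j 1) ⬝ᵥ D *ᵥ (A *ᵥ Pi.single j 1) = 0 := by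
      set v := (A *ᵥ Pi.single j 1) ⬝ᵥ D *ᵥ (A *ᵥ Pi.single j 1)
      set s := b ⬝ᵥ D *ᵥ (A *ᵥ Pi.single j 1)
      rw [← hβd] at h1 h2
      field_simp at h1
      nlinarith
    rw [dotProduct, Finset.sum_eq_zero_iff_of_nonneg] at h3
    · have := h3 i (Finset.mem_univ i)
      simpa [hD, Matrix.mulVec_diagonal, Matrix.col_apply, hi] using this
    · intro l _
      rw [hD, Matrix.mulVec_diagonal, mul_left_comm]
      exact mul_nonneg (hd l) (mul_self_nonneg _)
  set A₁ := A.toSquareBlockProp fun i => ¬ d i = 0 with hA₁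
  have hdet := abs_det_toSquareBlockProp_le A (fun i => d i = 0) hker
  rw [← hA₁] at hdet
  let d₁ : {i // ¬ d i = 0} → ℝ := fun i => d i
  let b₁ : {i // ¬ d i = 0} → ℝ := fun i => b i
  have hsum : ∀ f : Fin n → ℝ, (∀ i, d i = 0 → f i = 0) →
      ∑ i, f i = ∑ i : {i // ¬ d i = 0}, f i := by
    intro f hf
    rw [← Fintype.sum_subtype_add_sum_subtype (fun i => d i = 0) f]
    rw [Finset.sum_eq_zero fun i _ => hf i.1 i.2, zero_add]
  have hβ₁ : b₁ ⬝ᵥ Matrix.diagonal d₁ *ᵥ b₁ = β := by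
    rw [hβd, dotProduct, dotProduct, hsum]
    · simp [hD, Matrix.mulVec_diagonal, b₁, d₁]
    · intro i hi
      simp [hD, Matrix.mulVec_diagonal, hi]
  -- Rows and columns of `E` indexed by the kernel vanish, so the equation restricts to the block.
  have hblock : Matrix.diagonal d₁ = A₁ᵀ * (Matrix.diagonal d₁ - (1 / (1 + β)) •
      Matrix.vecMulVec (Matrix.diagonal d₁ *ᵥ b₁) (Matrix.diagonal d₁ *ᵥ b₁)) * A₁ := by
    ext i j
    have h1 : Matrix.diagonal d₁ i j = D i j := by
      simp [hD, d₁, Matrix.diagonal_apply, Subtype.ext_iff]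
    rw [h1, hDE, Matrix.mul_apply, Matrix.mul_apply, hsum]
    · refine Finset.sum_congr rfl fun l _ => ?_
      congr 1
      rw [Matrix.mul_apply, Matrix.mul_apply, hsum]
      · refine Finset.sum_congr rfl fun k _ => ?_
        simp [hE, hD, hA₁, d₁, b₁, Matrix.vecMulVec_apply, Matrix.mulVec_diagonal,
          Matrix.diagonal_apply, Matrix.toSquareBlockProp_def, Subtype.ext_iff]
      · intro k hk
        simp [hE, hD, Matrix.vecMulVec_apply, Matrix.mulVec_diagonal, Matrix.diagonal_apply, hk]
    · intro l hl
      rw [Matrix.mul_apply, Finset.sum_eq_zero, zero_mul]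
      intro k _
      have : E k l = 0 := by
        simp only [hE, hD, Matrix.vecMulVec_apply, Matrix.mulVec_diagonal, Matrix.diagonal_apply,
          hl, Matrix.sub_apply, Matrix.smul_apply, zero_mul, mul_zero, smul_zero, sub_zero]
        split_ifs with hkl
        · rw [hkl, hl]
        · rfl
      rw [this, mul_zero]
  have hdd : (Matrix.diagonal d₁).det ≠ 0 := by
    rw [Matrix.det_diagonal]
    exact Finset.prod_ne_zero_iff.mpr fun i _ => i.2
  have h5 := congrArg Matrix.det hblock
  rw [Matrix.det_mul, Matrix.det_mul, Matrix.det_transpose, det_diagonal_sub_vecMulVec, hβ₁] at h5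
  have h6 : 1 + β = A₁.det ^ 2 := by
    have h7 : (1 - 1 / (1 + β) * β) = 1 / (1 + β) := by field_simp; ring
    rw [h7] at h5
    field_simp at h5
    linarith
  rw [h6, ← sq_abs A₁.det]
  exact pow_le_pow_left₀ (abs_nonneg _) hdet 2

/-- Equivariance under orthogonal changes of basis, which reduces the determinant bound to diagonal
`P`. -/
theorem riccatiMap_conj {A P V : Matrix (Fin n) (Fin n) ℝ} {b : Fin n → ℝ} {γ r : ℝ}
    (hV : V * Vᵀ = 1) : Vᵀ * riccatiMap A b γ r 0 P * V =
      riccatiMap (Vᵀ * A * V) (Vᵀ *ᵥ b) γ r 0 (Vᵀ * P * V) := by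
  have h1 : (Vᵀ * P * V) *ᵥ (Vᵀ *ᵥ b) = Vᵀ *ᵥ (P *ᵥ b) := by
    rw [Matrix.mulVec_mulVec, Matrix.mul_assoc, hV, Matrix.mul_one, Matrix.mulVec_mulVec]
  have h2 : (Vᵀ * A * V)ᵀ *ᵥ (Vᵀ *ᵥ (P *ᵥ b)) = Vᵀ *ᵥ (Aᵀ *ᵥ (P *ᵥ b)) := by
    rw [Matrix.mulVec_mulVec, Matrix.transpose_mul, Matrix.transpose_mul,
      Matrix.transpose_transpose, Matrix.mul_assoc, Matrix.mul_assoc, hV, Matrix.mul_one,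
      ← Matrix.mulVec_mulVec]
  have h3 : (Vᵀ *ᵥ b) ⬝ᵥ (Vᵀ *ᵥ (P *ᵥ b)) = b ⬝ᵥ P *ᵥ b := by
    rw [Matrix.dotProduct_mulVec, Matrix.vecMul_transpose, Matrix.mulVec_mulVec, hV,
      Matrix.one_mulVec]
  have h4 : (Vᵀ * A * V)ᵀ * (Vᵀ * P * V) * (Vᵀ * A * V) = Vᵀ * (Aᵀ * P * A) * V := by
    simp only [Matrix.transpose_mul, Matrix.transpose_transpose]
    calc Vᵀ * (Aᵀ * V) * (Vᵀ * P * V) * (Vᵀ * A * V)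
        = Vᵀ * Aᵀ * (V * Vᵀ) * P * (V * Vᵀ) * A * V := by simp only [Matrix.mul_assoc]
      _ = _ := by rw [hV]; simp only [Matrix.mul_assoc, Matrix.one_mul]
  rw [riccatiMap, riccatiMap, h1, h2, h3, h4, add_zero, add_zero, Matrix.mul_sub, Matrix.sub_mul,
    Matrix.mul_smul, Matrix.smul_mul, Matrix.mul_vecMulVec, Matrix.vecMulVec_mul,
    ← Matrix.mulVec_transpose]

/-- For a positive semidefinite solution of the homogeneous Riccati equation, `1 + bᵀPb` is the
squared determinant of the map that `A` induces modulo `ker P`. -/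
theorem riccati_solution_bound {A P : Matrix (Fin n) (Fin n) ℝ} {b : Fin n → ℝ}
    (hP : P.PosSemidef) (h : P = riccatiMap A b 1 1 0 P) :
    1 + b ⬝ᵥ P *ᵥ b ≤ matrixMahlerMeasure A ^ 2 := by
  set V : Matrix (Fin n) (Fin n) ℝ := hP.isHermitian.eigenvectorUnitary.val with hVdef
  have hV1 : V * Vᵀ = 1 := by
    have := Unitary.coe_mul_star_self hP.isHermitian.eigenvectorUnitary
    rwa [Unitary.coe_star, Matrix.star_eq_conjTranspose,
      Matrix.conjTranspose_eq_transpose_of_trivial] at this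
  have hD : Vᵀ * P * V = Matrix.diagonal hP.isHermitian.eigenvalues := by
    have := hP.isHermitian.conjStarAlgAut_star_eigenvectorUnitary
    rw [Unitary.conjStarAlgAut_star_apply, Matrix.star_eq_conjTranspose,
      Matrix.conjTranspose_eq_transpose_of_trivial] at this
    exact this
  have h1 := riccatiMap_conj (A := A) (b := b) (γ := 1) (r := 1) (P := P) hV1
  rw [← h, hD] at h1
  have h2 := diagonal_riccati_bound (fun i => hP.eigenvalues_nonneg i) h1
  have h3 : (Vᵀ * A * V).charpoly = A.charpoly := by
    rw [Matrix.mul_assoc, Matrix.charpoly_mul_comm, Matrix.mul_assoc, hV1, Matrix.mul_one]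
  have h4 : (Vᵀ *ᵥ b) ⬝ᵥ Matrix.diagonal hP.isHermitian.eigenvalues *ᵥ (Vᵀ *ᵥ b) =
      b ⬝ᵥ P *ᵥ b := by
    rw [← hD, Matrix.mulVec_mulVec, Matrix.mul_assoc, hV1, Matrix.mul_one, ← Matrix.mulVec_mulVec,
      Matrix.dotProduct_mulVec, Matrix.vecMul_transpose, Matrix.mulVec_mulVec, hV1,
      Matrix.one_mulVec]
  rwa [h4, matrixMahlerMeasure_eq, h3, ← matrixMahlerMeasure_eq] at h2

end MahlerBound

/-! ### Solvability of the modified algebraic Riccati equation -/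

section Existence

variable {n : ℕ}

/-- The linear quadratic regulator: for a stabilizable pair, the Riccati equations with state cost
`ε` and unit input cost have uniformly bounded positive definite solutions. -/
theorem exists_lqr_solutions {A : Matrix (Fin n) (Fin n) ℝ} {b : Fin n → ℝ} {f : Fin n → ℝ}
    (hf : IsSchurStable (A + Matrix.vecMulVec b f)) :
    ∃ S : Matrix (Fin n) (Fin n) ℝ, ∀ ε : ℝ, 0 < ε → ε ≤ 1 →
      ∃ P : Matrix (Fin n) (Fin n) ℝ, P.PosDef ∧ P = riccatiMap A b 1 1 (ε • 1) P ∧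
        ∀ x : Fin n → ℝ, x ⬝ᵥ P *ᵥ x ≤ x ⬝ᵥ S *ᵥ x := by
  obtain ⟨S, hS, hSl⟩ := hf.exists_lyapunov
  have hself : ∀ y : Fin n → ℝ, 0 ≤ y ⬝ᵥ y := fun y =>
    Finset.sum_nonneg fun i _ => mul_self_nonneg _
  -- Under the feedback `f` the input cost is at most `|f|² |x|²` and the state cost at most `|x|²`;
  -- the decrease of `C • S` pays for both.
  set C := f ⬝ᵥ f + 1 with hC
  have hC0 : 0 ≤ C := by linarith [hself f]
  refine ⟨C • S, fun ε hε hε1 => ?_⟩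
  refine exists_riccati_solution zero_le_one le_rfl zero_le_one (Matrix.PosDef.one.smul hε)
    (hS.smul hC0) fun x => ?_
  refine (quad_riccatiMap_le zero_le_one zero_le_one (hS.smul hC0) x (f ⬝ᵥ x)).trans ?_
  have h1 := hSl x
  rw [Matrix.add_mulVec, Matrix.vecMulVec_mulVec, op_smul_eq_smul] at h1
  simp only [Matrix.smul_mulVec, dotProduct_smul, smul_eq_mul, Matrix.one_mulVec]
  have h2 : (f ⬝ᵥ x) ^ 2 ≤ (f ⬝ᵥ f) * (x ⬝ᵥ x) := by
    have := Finset.sum_mul_sq_le_sq_mul_sq Finset.univ f x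
    simpa [dotProduct, ← pow_two] using this
  have h3 := mul_le_mul_of_nonneg_left h1 hC0
  have h4 : ε * (x ⬝ᵥ x) ≤ 1 * (x ⬝ᵥ x) := mul_le_mul_of_nonneg_right hε1 (hself x)
  have h5 : C * (x ⬝ᵥ x) = (f ⬝ᵥ f) * (x ⬝ᵥ x) + x ⬝ᵥ x := by rw [hC]; ring
  linarith

/-- Positive semidefinite matrices below a fixed one form a relatively compact set. -/
theorem exists_subseq_tendsto_of_quad_le {S : Matrix (Fin n) (Fin n) ℝ}
    {R : ℕ → Matrix (Fin n) (Fin n) ℝ} (hR : ∀ k, (R k).PosSemidef)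
    (hle : ∀ k x, x ⬝ᵥ R k *ᵥ x ≤ x ⬝ᵥ S *ᵥ x) :
    ∃ P : Matrix (Fin n) (Fin n) ℝ, P.PosSemidef ∧
      ∃ φ : ℕ → ℕ, StrictMono φ ∧ Tendsto (R ∘ φ) atTop (𝓝 P) := by
  let q : (Fin n → ℝ) → ℝ := fun x => x ⬝ᵥ S *ᵥ x
  let c : Fin n → Fin n → ℝ := fun i j =>
    q (Pi.single i 1 + Pi.single j 1) + q (Pi.single i 1) + q (Pi.single j 1)
  have hK : IsCompact (Set.univ.pi fun i => Set.univ.pi fun j => Set.Icc (-c i j) (c i j) :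
      Set (Fin n → Fin n → ℝ)) :=
    isCompact_univ_pi fun i => isCompact_univ_pi fun j => isCompact_Icc
  have hmem : ∀ k, R k ∈ (Set.univ.pi fun i => Set.univ.pi fun j => Set.Icc (-c i j) (c i j) :
      Set (Fin n → Fin n → ℝ)) := by
    intro k i _ j _
    rw [apply_eq_polarization (hR k).isSymm_real i j]
    have h1 := (hR k).quad_nonneg (Pi.single i 1 + Pi.single j 1)
    have h2 := (hR k).quad_nonneg (Pi.single i 1)
    have h3 := (hR k).quad_nonneg (Pi.single j 1)
    have h4 := hle k (Pi.single i 1 + Pi.single j 1)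
    have h5 := hle k (Pi.single i 1)
    have h6 := hle k (Pi.single j 1)
    simp only [c, q]
    constructor <;> linarith
  obtain ⟨P, -, φ, hφ, hP⟩ := hK.tendsto_subseq hmem
  have hP' : Tendsto (R ∘ φ) atTop (𝓝 (P : Matrix (Fin n) (Fin n) ℝ)) := hP
  refine ⟨P, posSemidef_of_quad_nonneg ?_ fun x => ?_, φ, hφ, hP'⟩
  · exact isClosed_isSymm.mem_of_tendsto hP' (Eventually.of_forall fun k => (hR _).isSymm_real)
  · exact ge_of_tendsto' (tendsto_quad hP' x) fun k => (hR _).quad_nonneg x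

/-- The modified algebraic Riccati equation of a stabilizable pair is solvable as soon as
`δ² M(A)² < 1`. -/
theorem exists_modified_riccati_solution {A Q : Matrix (Fin n) (Fin n) ℝ} {b f : Fin n → ℝ}
    (hf : IsSchurStable (A + Matrix.vecMulVec b f)) (hQ : Q.PosDef) {δ : ℝ}
    (hδ : δ ^ 2 < 1 / matrixMahlerMeasure A ^ 2) :
    ∃ P : Matrix (Fin n) (Fin n) ℝ, P.PosDef ∧ P = riccatiMap A b (1 - δ ^ 2) 0 Q P := by
  have hM := one_le_matrixMahlerMeasure A
  have hM2 : 1 ≤ matrixMahlerMeasure A ^ 2 := one_le_pow₀ hM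
  have hδ1 : δ ^ 2 ≤ 1 := hδ.le.trans (by rw [div_le_one (by linarith)]; exact hM2)
  obtain ⟨S, hS⟩ := exists_lqr_solutions hf
  have hε : ∀ k : ℕ, 0 < 1 / ((k : ℝ) + 1) ∧ 1 / ((k : ℝ) + 1) ≤ 1 := fun k =>
    ⟨by positivity, by rw [div_le_one (by positivity)]; linarith [(k.cast_nonneg : (0 : ℝ) ≤ k)]⟩
  choose R hRpd hRe hRS using fun k : ℕ => hS _ (hε k).1 (hε k).2
  obtain ⟨P₀, hP₀, φ, hφ, hlim⟩ :=
    exists_subseq_tendsto_of_quad_le (fun k => (hRpd k).posSemidef) hRS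
  have hlimQ : Tendsto (fun k => (1 / ((φ k : ℝ) + 1)) • (1 : Matrix (Fin n) (Fin n) ℝ)) atTop
      (𝓝 0) := by
    have := (tendsto_one_div_add_atTop_nhds_zero_nat (𝕜 := ℝ)).comp hφ.tendsto_atTop
    simpa using this.smul_const (1 : Matrix (Fin n) (Fin n) ℝ)
  have hP₀e : P₀ = riccatiMap A b 1 1 0 P₀ := by
    refine tendsto_nhds_unique hlim ?_
    have h1 := tendsto_riccatiMap (A := A) (b := b) (γ := 1) (r := 1) (P := P₀) (Q := 0)
      (fun h => by have := hP₀.quad_nonneg b; linarith) hlim hlimQ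
    exact h1.congr fun k => (hRe (φ k)).symm
  have hbd := riccati_solution_bound hP₀ hP₀e
  have hlt : δ ^ 2 * (1 + b ⬝ᵥ P₀ *ᵥ b) < 1 := by
    rw [lt_div_iff₀ (by linarith)] at hδ
    exact (mul_le_mul_of_nonneg_left hbd (sq_nonneg δ)).trans_lt hδ
  -- The limit `P₀` may be singular, so the strict inequality is carried back to a positive definite
  -- approximant.
  have hev : ∀ᶠ k in atTop, δ ^ 2 * (1 + b ⬝ᵥ (R ∘ φ) k *ᵥ b) < 1 :=
    (((tendsto_quad hlim b).const_add 1).const_mul (δ ^ 2)).eventually_lt_const hlt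
  obtain ⟨k, hk⟩ := hev.exists
  simp only [Function.comp_apply] at hk
  obtain ⟨hP, hPe, hε0⟩ := And.intro (hRpd (φ k)) (And.intro (hRe (φ k)) (hε (φ k)).1)
  set P := R (φ k)
  set ε := 1 / ((φ k : ℝ) + 1)
  obtain ⟨C, hC0, hC⟩ := exists_quad_le_mul Q
    (Q := ε • (1 : Matrix (Fin n) (Fin n) ℝ)) (Matrix.PosDef.one.smul hε0)
  have hsup : ∀ x : Fin n → ℝ, x ⬝ᵥ riccatiMap A b (1 - δ ^ 2) 0 Q (C • P) *ᵥ x ≤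
      x ⬝ᵥ (C • P) *ᵥ x := by
    intro x
    have h1 := quad_riccatiMap (A := A) (b := b) (γ := 1) (r := 1)
      (Q := ε • (1 : Matrix (Fin n) (Fin n) ℝ)) hP.isSymm_real x
    rw [← hPe] at h1
    rw [quad_riccatiMap (hP.smul hC0).isSymm_real]
    simp only [Matrix.smul_mulVec, dotProduct_smul, smul_eq_mul, zero_add] at h1 hC ⊢
    have hcs := hP.posSemidef.quad_sq_le b (A *ᵥ x)
    have hβ := hP.posSemidef.quad_nonneg b
    set s := b ⬝ᵥ P *ᵥ (A *ᵥ x)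
    set β := b ⬝ᵥ P *ᵥ b
    -- For `β > 0` and after cancelling `s²`, this is `β ≤ (1 - δ²)(1 + β)`, that is, `δ² (1 + β) ≤
    -- 1`.
    have hkey : 1 / (1 + β) * s ^ 2 ≤ (1 - δ ^ 2) / (C * β) * C * s ^ 2 * 1 := by
      rcases hβ.eq_or_lt with h | h
      · have hs : s ^ 2 = 0 := le_antisymm (by rwa [← h, zero_mul] at hcs) (sq_nonneg _)
        simp [hs]
      · have h2 : (1 - δ ^ 2) / (C * β) * C = (1 - δ ^ 2) / β := by field_simp
        rw [h2, mul_one]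
        refine mul_le_mul_of_nonneg_right ?_ (sq_nonneg s)
        rw [div_le_div_iff₀ (by positivity) h]
        linarith
    have h3 := mul_le_mul_of_nonneg_left hkey hC0.le
    have h4 := hC x
    have h5 : (1 - δ ^ 2) / (C * β) * (C * s) ^ 2 =
        C * ((1 - δ ^ 2) / (C * β) * C * s ^ 2 * 1) := by ring
    rw [h5, h1]
    linarith
  obtain ⟨T, hT, hTe, -⟩ := exists_riccati_solution (by linarith) (by linarith [sq_nonneg δ]) le_rfl
    hQ (hP.smul hC0).posSemidef hsup
  exact ⟨T, hT, hTe⟩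

theorem existsUnique_modified_riccati_solution {A Q : Matrix (Fin n) (Fin n) ℝ} {b f : Fin n → ℝ}
    (hf : IsSchurStable (A + Matrix.vecMulVec b f)) (hQ : Q.PosDef) {δ : ℝ}
    (hδ : δ ^ 2 < 1 / matrixMahlerMeasure A ^ 2) :
    ∃! P : Matrix (Fin n) (Fin n) ℝ, P.PosDef ∧ P = riccatiMap A b (1 - δ ^ 2) 0 Q P := by
  have hM2 : 1 ≤ matrixMahlerMeasure A ^ 2 := one_le_pow₀ (one_le_matrixMahlerMeasure A)
  have hδ1 : δ ^ 2 ≤ 1 := hδ.le.trans (by rw [div_le_one (by linarith)]; exact hM2)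
  obtain ⟨P, hP, hPe⟩ := exists_modified_riccati_solution hf hQ hδ
  refine ⟨P, ⟨hP, hPe⟩, fun T ⟨hT, hTe⟩ => ?_⟩
  have h1 : 0 ≤ 1 - δ ^ 2 := by linarith
  have h2 : 1 - δ ^ 2 ≤ 1 := by linarith [sq_nonneg δ]
  exact eq_of_quad_eq hT.isSymm_real hP.isSymm_real fun x => le_antisymm
    (riccati_solution_le h1 h2 le_rfl hQ hT hTe hP hPe x)
    (riccati_solution_le h1 h2 le_rfl hQ hP hPe hT hTe x)

theorem matrix_fin_one_mul_eq_vecMulVec (B : Matrix (Fin n) (Fin 1) ℝ)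
    (F : Matrix (Fin 1) (Fin n) ℝ) : B * F = Matrix.vecMulVec (fun i => B i 0) (F 0) := by
  ext i j
  simp [Matrix.mul_apply, Matrix.vecMulVec_apply]

/-- Matrix inverse and scalar inverse both send zero to zero, so `B = 0` needs no separate
treatment. -/
theorem inv_transpose_mul_mul_apply (B : Matrix (Fin n) (Fin 1) ℝ) (P : Matrix (Fin n) (Fin n) ℝ)
    (i j : Fin 1) :
    (Bᵀ * P * B)⁻¹ i j = ((fun i => B i 0) ⬝ᵥ P *ᵥ (fun i => B i 0))⁻¹ := by
  obtain rfl := Subsingleton.elim i 0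
  obtain rfl := Subsingleton.elim j 0
  rw [Matrix.inv_subsingleton, Matrix.diagonal_apply_eq, Ring.inverse_eq_inv', Matrix.mul_assoc]
  rfl

theorem riccati_quotient_eq {A P : Matrix (Fin n) (Fin n) ℝ} (B : Matrix (Fin n) (Fin 1) ℝ)
    (hP : P.IsSymm) : Aᵀ * P * B * (Bᵀ * P * B)⁻¹ * Bᵀ * P * A =
      ((fun i => B i 0) ⬝ᵥ P *ᵥ (fun i => B i 0))⁻¹ •
        Matrix.vecMulVec (Aᵀ *ᵥ (P *ᵥ fun i => B i 0)) (Aᵀ *ᵥ (P *ᵥ fun i => B i 0)) := by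
  have h1 : Aᵀ * P * B * (Bᵀ * P * B)⁻¹ * Bᵀ * P * A =
      Aᵀ * (P * B) * (Bᵀ * P * B)⁻¹ * (Aᵀ * (P * B))ᵀ := by
    rw [Matrix.transpose_mul, Matrix.transpose_mul, Matrix.transpose_transpose, hP.eq]
    simp only [Matrix.mul_assoc]
  rw [h1]
  ext i j
  rw [Matrix.mul_apply, Fin.sum_univ_one, Matrix.mul_apply, Fin.sum_univ_one,
    inv_transpose_mul_mul_apply, Matrix.smul_apply, Matrix.vecMulVec_apply, smul_eq_mul,
    Matrix.transpose_apply]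
  have h2 : ∀ k, (Aᵀ * (P * B)) k 0 = (Aᵀ *ᵥ (P *ᵥ fun i => B i 0)) k := fun k => rfl
  rw [h2, h2]
  ring

theorem solvesMARE_iff {A Q P : Matrix (Fin n) (Fin n) ℝ} {B : Matrix (Fin n) (Fin 1) ℝ} {δ : ℝ}
    (hP : P.IsSymm) : SolvesMARE A B Q δ P ↔
      P = riccatiMap A (fun i => B i 0) (1 - δ ^ 2) 0 Q P := by
  rw [SolvesMARE, riccati_quotient_eq B hP, riccatiMap, smul_smul, zero_add, div_eq_mul_inv]

theorem mareGain_mulVec (A P : Matrix (Fin n) (Fin n) ℝ) (B : Matrix (Fin n) (Fin 1) ℝ)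
    (x : Fin n → ℝ) : (mareGain A B P *ᵥ x) 0 =
      -(((fun i => B i 0) ⬝ᵥ P *ᵥ (A *ᵥ x)) / ((fun i => B i 0) ⬝ᵥ P *ᵥ (fun i => B i 0))) := by
  rw [mareGain, Matrix.neg_mulVec, Pi.neg_apply, neg_inj, Matrix.mul_assoc, Matrix.mul_assoc,
    ← Matrix.mulVec_mulVec, Matrix.mulVec, dotProduct, Fin.sum_univ_one,
    inv_transpose_mul_mul_apply, ← Matrix.mulVec_mulVec, ← Matrix.mulVec_mulVec, div_eq_inv_mul]
  rfl

end Existence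

/-! ### Spectral and edge-sum estimates for the Laplacian -/

section Laplacian

variable {N : ℕ}

theorem Matrix.IsHermitian.exists_diagonalization {L : Matrix (Fin N) (Fin N) ℝ}
    (hL : L.IsHermitian) : ∃ (V : Matrix (Fin N) (Fin N) ℝ) (d : Fin N → ℝ),
      V * Vᵀ = 1 ∧ Vᵀ * V = 1 ∧ L = V * Matrix.diagonal d * Vᵀ := by
  have h1 := Unitary.coe_mul_star_self hL.eigenvectorUnitary
  have h2 := Unitary.coe_star_mul_self hL.eigenvectorUnitary
  have h3 := hL.spectral_theorem
  rw [Unitary.conjStarAlgAut_apply] at h3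
  simp only [Unitary.coe_star, Matrix.star_eq_conjTranspose,
    Matrix.conjTranspose_eq_transpose_of_trivial] at h1 h2 h3
  exact ⟨_, _, h1, h2, h3⟩

theorem lapMatrix_mulVec_eq_sum (G : SimpleGraph (Fin N)) [DecidableRel G.Adj] (z : Fin N → ℝ)
    (i : Fin N) : (G.lapMatrix ℝ *ᵥ z) i = ∑ j, G.adjMatrix ℝ i j * (z i - z j) := by
  rw [SimpleGraph.lapMatrix_mulVec_apply, ← SimpleGraph.card_neighborFinset_eq_degree]
  simp only [SimpleGraph.adjMatrix_apply, ite_mul, one_mul, zero_mul, ← Finset.sum_filter]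
  rw [Finset.sum_sub_distrib, Finset.sum_const, nsmul_eq_mul,
    SimpleGraph.neighborFinset_eq_filter]

theorem dotProduct_lapMatrix_mulVec_self (G : SimpleGraph (Fin N)) [DecidableRel G.Adj]
    (z : Fin N → ℝ) : z ⬝ᵥ G.lapMatrix ℝ *ᵥ z =
      (∑ i, ∑ j, G.adjMatrix ℝ i j * (z i - z j) ^ 2) / 2 := by
  have := G.lapMatrix_toLinearMap₂' ℝ z
  rw [Matrix.toLinearMap₂'_apply'] at this
  rw [this]
  simp [SimpleGraph.adjMatrix_apply]

theorem sum_lapMatrix_mulVec (G : SimpleGraph (Fin N)) [DecidableRel G.Adj] (z : Fin N → ℝ) :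
    ∑ i, (G.lapMatrix ℝ *ᵥ z) i = 0 := by
  have h : ∑ i, (G.lapMatrix ℝ *ᵥ z) i = (fun _ => 1) ⬝ᵥ G.lapMatrix ℝ *ᵥ z := by
    simp [dotProduct]
  rw [h, Matrix.dotProduct_mulVec, ← Matrix.mulVec_transpose, (G.isSymm_lapMatrix (R := ℝ)).eq,
    SimpleGraph.lapMatrix_mulVec_const_eq_zero, zero_dotProduct]

/-- A convex quadratic condition at the extreme nonzero Laplacian eigenvalues gives a quadratic
form inequality on the vectors of mean zero. -/
theorem lapMatrix_quadratic_bound {G : SimpleGraph (Fin N)} [DecidableRel G.Adj]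
    (hG : G.Connected) {lam2 lamN α s δ : ℝ} (hlam2 : IsLeast (nonzeroLapEigenvalues G) lam2)
    (hlamN : IsGreatest (nonzeroLapEigenvalues G) lamN)
    (h2 : (α * lam2 - 1) ^ 2 + α ^ 2 * s * lam2 ≤ δ ^ 2)
    (hN : (α * lamN - 1) ^ 2 + α ^ 2 * s * lamN ≤ δ ^ 2)
    {z : Fin N → ℝ} (hz : ∑ i, z i = 0) :
    α ^ 2 * ((G.lapMatrix ℝ *ᵥ z) ⬝ᵥ (G.lapMatrix ℝ *ᵥ z)) +
      (α ^ 2 * s - 2 * α) * (z ⬝ᵥ G.lapMatrix ℝ *ᵥ z) ≤ -(1 - δ ^ 2) * (z ⬝ᵥ z) := by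
  obtain ⟨V, d, hV1, hV2, hL⟩ := (G.isHermitian_lapMatrix (R := ℝ)).exists_diagonalization
  set L := G.lapMatrix ℝ with hLdef
  set w := Vᵀ *ᵥ z with hw
  have hiso : ∀ u v : Fin N → ℝ, (V *ᵥ u) ⬝ᵥ (V *ᵥ v) = u ⬝ᵥ v := by
    intro u v
    rw [← Matrix.vecMul_transpose, ← Matrix.dotProduct_mulVec, Matrix.mulVec_mulVec, hV2,
      Matrix.one_mulVec]
  have hzw : z = V *ᵥ w := by rw [hw, Matrix.mulVec_mulVec, hV1, Matrix.one_mulVec]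
  have hLz : L *ᵥ z = V *ᵥ (Matrix.diagonal d *ᵥ w) := by
    rw [hL, hw, Matrix.mulVec_mulVec, Matrix.mulVec_mulVec]
  have e1 : z ⬝ᵥ z = ∑ i, w i ^ 2 := by
    conv_lhs => rw [hzw, hiso]
    simp [dotProduct, pow_two]
  have e2 : z ⬝ᵥ L *ᵥ z = ∑ i, d i * w i ^ 2 := by
    rw [hLz]
    conv_lhs => rw [hzw, hiso]
    simp only [dotProduct, Matrix.mulVec_diagonal]
    exact Finset.sum_congr rfl fun i _ => by ring
  have e3 : (L *ᵥ z) ⬝ᵥ (L *ᵥ z) = ∑ i, d i ^ 2 * w i ^ 2 := by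
    rw [hLz, hiso]
    simp only [dotProduct, Matrix.mulVec_diagonal]
    exact Finset.sum_congr rfl fun i _ => by ring
  rw [e1, e2, e3, Finset.mul_sum, Finset.mul_sum, Finset.mul_sum, ← Finset.sum_add_distrib]
  refine Finset.sum_le_sum fun i _ => ?_
  have heig : L *ᵥ (V *ᵥ Pi.single i 1) = d i • (V *ᵥ Pi.single i 1) := by
    rw [hL, Matrix.mulVec_mulVec, Matrix.mul_assoc, hV2, Matrix.mul_one, ← Matrix.mulVec_mulVec,
      Matrix.diagonal_mulVec_single, mul_one, ← Matrix.mulVec_smul]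
    congr 1
    rw [← Pi.single_smul, smul_eq_mul, mul_one]
  have hne : V *ᵥ Pi.single i 1 ≠ 0 := by
    intro h
    have h1 := hiso (Pi.single i 1) (Pi.single i 1)
    rw [h] at h1
    simp at h1
  -- By connectedness a kernel eigenvector is constant, hence orthogonal to `z`, and this mode does
  -- not contribute.
  by_cases hd : d i = 0
  · rw [hd, zero_smul, hLdef, SimpleGraph.lapMatrix_mulVec_eq_zero_iff_forall_reachable] at heig
    have hwi : w i = 0 := by
      have h1 : w i = Pi.single i 1 ⬝ᵥ w := by simp
      rw [h1, hw, Matrix.dotProduct_mulVec, Matrix.vecMul_transpose, dotProduct]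
      have h2 : ∀ j, (V *ᵥ Pi.single i 1) j = (V *ᵥ Pi.single i 1) i := fun j =>
        heig _ _ (hG.preconnected j i)
      simp_rw [h2]
      rw [← Finset.mul_sum, hz, mul_zero]
    simp [hwi]
  · have hmem : d i ∈ nonzeroLapEigenvalues G :=
      ⟨hd, Module.End.hasEigenvalue_of_hasEigenvector
        (x := V *ᵥ Pi.single i 1) ⟨Module.End.mem_eigenspace_iff.mpr (by
          rw [Matrix.toLin'_apply]; exact heig), hne⟩⟩
    have hlo := hlam2.2 hmem
    have hhi := hlamN.2 hmem
    -- Convexity by the chord: the weighted mean of the end values exceeds the value at `d i` by `α²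
    -- (d i - lam2) (lamN - d i)`.
    have key : (α * d i - 1) ^ 2 + α ^ 2 * s * d i ≤ δ ^ 2 := by
      rcases hlo.eq_or_lt with h | h
      · rwa [← h]
      have hpos : 0 < lamN - lam2 := by linarith
      have i1 := mul_le_mul_of_nonneg_left h2 (sub_nonneg.mpr hhi)
      have i2 := mul_le_mul_of_nonneg_left hN (sub_nonneg.mpr hlo)
      have i3 : 0 ≤ α ^ 2 * ((d i - lam2) * (lamN - d i)) * (lamN - lam2) :=
        mul_nonneg (mul_nonneg (sq_nonneg α) (mul_nonneg (by linarith) (by linarith))) hpos.le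
      refine le_of_mul_le_mul_left ?_ hpos
      linarith
    have := mul_le_mul_of_nonneg_right key (sq_nonneg (w i))
    linarith

/-- The total noise power is controlled by the largest edge variance. -/
theorem sum_variance_le {G : SimpleGraph (Fin N)} [DecidableRel G.Adj] {σ : Fin N → Fin N → ℝ}
    {s : ℝ} (hs : s ∈ upperBounds (edgeVariances G σ)) (z : Fin N → ℝ) :
    ∑ i, ∑ j, G.adjMatrix ℝ i j * σ i j ^ 2 * (z i - z j) ^ 2 ≤ s * (z ⬝ᵥ G.lapMatrix ℝ *ᵥ z) := by
  rw [dotProduct_lapMatrix_mulVec_self]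
  -- Averaging over both orientations of each edge produces `σ_ij² + σ_ji²`; the factor 2 cancels
  -- the half in the Laplacian form.
  have hcomm : ∑ i, ∑ j, G.adjMatrix ℝ i j * σ i j ^ 2 * (z i - z j) ^ 2 =
      ∑ i, ∑ j, G.adjMatrix ℝ i j * σ j i ^ 2 * (z i - z j) ^ 2 := by
    rw [Finset.sum_comm]
    refine Finset.sum_congr rfl fun i _ => Finset.sum_congr rfl fun j _ => ?_
    simp only [SimpleGraph.adjMatrix_apply, G.adj_comm j i]
    ring
  have hle : ∑ i, ∑ j, G.adjMatrix ℝ i j * σ i j ^ 2 * (z i - z j) ^ 2 +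
      ∑ i, ∑ j, G.adjMatrix ℝ i j * σ j i ^ 2 * (z i - z j) ^ 2 ≤
      s * ∑ i, ∑ j, G.adjMatrix ℝ i j * (z i - z j) ^ 2 := by
    rw [← Finset.sum_add_distrib, Finset.mul_sum]
    refine Finset.sum_le_sum fun i _ => ?_
    rw [← Finset.sum_add_distrib, Finset.mul_sum]
    refine Finset.sum_le_sum fun j _ => ?_
    by_cases h : G.Adj i j
    · have h1 := hs ⟨i, j, h, rfl⟩
      have h2 := mul_le_mul_of_nonneg_right h1 (sq_nonneg (z i - z j))
      simp only [SimpleGraph.adjMatrix_apply, h, if_true]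
      linarith
    · simp [h]
  linarith

end Laplacian

/-! ### Deviation dynamics and the Lyapunov inequality -/

section Disagreement

variable {N n : ℕ}

/-- The deviation of each agent from the average state. -/
noncomputable def deviation (x : Fin N → Fin n → ℝ) (i : Fin N) : Fin n → ℝ :=
  x i - (N : ℝ)⁻¹ • ∑ j, x j

/-- The Lyapunov function of the disagreement. -/
noncomputable def disagreement (P : Matrix (Fin n) (Fin n) ℝ) (x : Fin N → Fin n → ℝ) : ℝ :=
  ∑ i, deviation x i ⬝ᵥ P *ᵥ deviation x i

theorem sum_deviation (x : Fin N → Fin n → ℝ) : ∑ i, deviation x i = 0 := by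
  by_cases hN : N = 0
  · subst hN; simp
  have hN' : (N : ℝ) ≠ 0 := by exact_mod_cast hN
  simp only [deviation, Finset.sum_sub_distrib, Finset.sum_const, Finset.card_univ,
    Fintype.card_fin]
  rw [← Nat.cast_smul_eq_nsmul ℝ, smul_smul, mul_inv_cancel₀ hN', one_smul, sub_self]

theorem deviation_add (x y : Fin N → Fin n → ℝ) (i : Fin N) :
    deviation (x + y) i = deviation x i + deviation y i := by
  simp only [deviation, Pi.add_apply, Finset.sum_add_distrib, smul_add]
  abel

theorem deviation_mulVec (A : Matrix (Fin n) (Fin n) ℝ) (x : Fin N → Fin n → ℝ) (i : Fin N) :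
    deviation (fun i => A *ᵥ x i) i = A *ᵥ deviation x i := by
  simp only [deviation, Matrix.mulVec_sub, Matrix.mulVec_smul, Matrix.mulVec_sum]

theorem deviation_smul (c : Fin N → ℝ) (b : Fin n → ℝ) (i : Fin N) :
    deviation (fun i => c i • b) i = (c i - (N : ℝ)⁻¹ * ∑ j, c j) • b := by
  simp only [deviation, ← Finset.sum_smul, smul_smul, sub_smul]

/-- The projected input `K x_i` of agent `i`. -/
noncomputable def gainOutput (K : Matrix (Fin 1) (Fin n) ℝ) (x : Fin N → Fin n → ℝ)
    (i : Fin N) : ℝ := (K *ᵥ x i) 0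

/-- The noise part of the control input of agent `i` (without the factor `α`), with the noises
already multiplied by the adjacency weights. -/
noncomputable def noiseInput (K : Matrix (Fin 1) (Fin n) ℝ) (D : Fin N → Fin N → ℝ)
    (x : Fin N → Fin n → ℝ) (i : Fin N) : ℝ :=
  ∑ j, D i j * (gainOutput K x i - gainOutput K x j)

/-- The closed loop without noise. -/
noncomputable def meanStep (G : SimpleGraph (Fin N)) [DecidableRel G.Adj]
    (A : Matrix (Fin n) (Fin n) ℝ) (b : Fin n → ℝ) (α : ℝ) (K : Matrix (Fin 1) (Fin n) ℝ)
    (x : Fin N → Fin n → ℝ) (i : Fin N) : Fin n → ℝ :=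
  A *ᵥ x i + (α * (G.lapMatrix ℝ *ᵥ gainOutput K x) i) • b

theorem step_eq (G : SimpleGraph (Fin N)) [DecidableRel G.Adj]
    (A : Matrix (Fin n) (Fin n) ℝ) (B : Matrix (Fin n) (Fin 1) ℝ) (α : ℝ)
    (K : Matrix (Fin 1) (Fin n) ℝ) (D : Fin N → Fin N → ℝ) (x : Fin N → Fin n → ℝ) (i : Fin N) :
    A *ᵥ x i + B *ᵥ protocolInput G α K D x i =
      meanStep G A (fun a => B a 0) α K x i +
        (α * noiseInput K (fun i j => G.adjMatrix ℝ i j * D i j) x i) • fun a => B a 0 := by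
  rw [meanStep, add_assoc, ← add_smul, ← mul_add]
  congr 1
  have h : protocolInput G α K D x i 0 = α * ((G.lapMatrix ℝ *ᵥ gainOutput K x) i +
      noiseInput K (fun i j => G.adjMatrix ℝ i j * D i j) x i) := by
    rw [lapMatrix_mulVec_eq_sum, noiseInput, ← Finset.sum_add_distrib, protocolInput]
    simp only [Pi.smul_apply, Finset.sum_apply, smul_eq_mul, Matrix.mulVec_sub, Pi.sub_apply,
      gainOutput]
    congr 1
    exact Finset.sum_congr rfl fun j _ => by ring
  ext a
  rw [Matrix.mulVec, dotProduct, Fin.sum_univ_one, h, Pi.smul_apply, smul_eq_mul, mul_comm]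

/-- The noise inputs need not sum to zero, since the two directions of an edge carry different
noises; removing their average only lowers their power. -/
theorem sum_sub_mean_sq_le (w : Fin N → ℝ) :
    ∑ i, (w i - (N : ℝ)⁻¹ * ∑ j, w j) ^ 2 ≤ ∑ i, w i ^ 2 := by
  by_cases hN : N = 0
  · subst hN; simp
  have hN' : (0 : ℝ) < N := by exact_mod_cast Nat.pos_of_ne_zero hN
  set m := (N : ℝ)⁻¹ * ∑ j, w j with hm
  have h1 : ∑ j, w j = N * m := by rw [hm, mul_inv_cancel_left₀ hN'.ne']
  have h2 : ∑ i, (w i - m) ^ 2 = ∑ i, w i ^ 2 - 2 * m * ∑ i, w i + N * m ^ 2 := by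
    simp_rw [sub_sq]
    rw [Finset.sum_add_distrib, Finset.sum_sub_distrib, Finset.sum_const, Finset.card_univ,
      Fintype.card_fin, nsmul_eq_mul, Finset.mul_sum]
    congr 2
    exact Finset.sum_congr rfl fun j _ => by ring
  rw [h2, h1]
  nlinarith [mul_nonneg hN'.le (sq_nonneg m)]

variable {G : SimpleGraph (Fin N)} [DecidableRel G.Adj] {A P Q : Matrix (Fin n) (Fin n) ℝ}
  {b : Fin n → ℝ} {α : ℝ} {K : Matrix (Fin 1) (Fin n) ℝ}

theorem deviation_meanStep (x : Fin N → Fin n → ℝ) (i : Fin N) :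
    deviation (meanStep G A b α K x) i =
      A *ᵥ deviation x i + (α * (G.lapMatrix ℝ *ᵥ gainOutput K x) i) • b := by
  have h : meanStep G A b α K x = (fun i => A *ᵥ x i) +
      fun i => (α * (G.lapMatrix ℝ *ᵥ gainOutput K x) i) • b := rfl
  rw [h, deviation_add, deviation_mulVec, deviation_smul, ← Finset.mul_sum, sum_lapMatrix_mulVec,
    mul_zero, mul_zero, sub_zero]

/-- The disagreement after a noisy step. -/
theorem disagreement_step_le (hP : P.PosSemidef) (w : Fin N → ℝ) (x : Fin N → Fin n → ℝ) :
    disagreement P (fun i => x i + (α * w i) • b) ≤ disagreement P x +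
      2 * α * ∑ i, w i * (b ⬝ᵥ P *ᵥ deviation x i) + α ^ 2 * (b ⬝ᵥ P *ᵥ b) * ∑ i, w i ^ 2 := by
  set m := (N : ℝ)⁻¹ * ∑ j, w j with hm
  have hdev : ∀ i, deviation (fun i => x i + (α * w i) • b) i =
      deviation x i + (α * (w i - m)) • b := by
    intro i
    have h : (fun i => x i + (α * w i) • b) = x + fun i => (α * w i) • b := rfl
    rw [h, deviation_add, deviation_smul, ← Finset.mul_sum, hm]
    congr 2
    ring
  have hcross : ∑ i, m * (b ⬝ᵥ P *ᵥ deviation x i) = 0 := by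
    rw [← Finset.mul_sum, ← dotProduct_sum, ← Matrix.mulVec_sum, sum_deviation, Matrix.mulVec_zero,
      dotProduct_zero, mul_zero]
  have h1 : disagreement P (fun i => x i + (α * w i) • b) = disagreement P x +
      2 * α * (∑ i, w i * (b ⬝ᵥ P *ᵥ deviation x i) - ∑ i, m * (b ⬝ᵥ P *ᵥ deviation x i)) +
      α ^ 2 * (b ⬝ᵥ P *ᵥ b) * ∑ i, (w i - m) ^ 2 := by
    simp only [disagreement, hdev, quad_add_smul hP.isSymm_real]
    rw [← Finset.sum_sub_distrib, Finset.mul_sum, Finset.mul_sum, ← Finset.sum_add_distrib,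
      ← Finset.sum_add_distrib]
    exact Finset.sum_congr rfl fun i _ => by ring
  rw [h1, hcross, sub_zero]
  have := mul_le_mul_of_nonneg_left (sum_sub_mean_sq_le w)
    (mul_nonneg (sq_nonneg α) (hP.quad_nonneg b))
  linarith

/-- The disagreement is a Lyapunov function for the mean dynamics, with room for the noise power. -/
theorem disagreement_meanStep_add_noise_le (hG : G.Connected) {σ : Fin N → Fin N → ℝ}
    {lam2 lamN s δ : ℝ} (hs : s ∈ upperBounds (edgeVariances G σ))
    (hlam2 : IsLeast (nonzeroLapEigenvalues G) lam2)
    (hlamN : IsGreatest (nonzeroLapEigenvalues G) lamN)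
    (h2 : (α * lam2 - 1) ^ 2 + α ^ 2 * s * lam2 ≤ δ ^ 2)
    (hN : (α * lamN - 1) ^ 2 + α ^ 2 * s * lamN ≤ δ ^ 2)
    (hP : P.PosDef) (hPe : P = riccatiMap A b (1 - δ ^ 2) 0 Q P)
    (hK : ∀ x : Fin n → ℝ, (K *ᵥ x) 0 = -((b ⬝ᵥ P *ᵥ (A *ᵥ x)) / (b ⬝ᵥ P *ᵥ b)))
    (x : Fin N → Fin n → ℝ) :
    disagreement P (meanStep G A b α K x) + α ^ 2 * (b ⬝ᵥ P *ᵥ b) *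
      ∑ i, ∑ j, G.adjMatrix ℝ i j * σ i j ^ 2 * (gainOutput K x i - gainOutput K x j) ^ 2 ≤
    disagreement P x - disagreement Q x := by
  have hβ := hP.posSemidef.quad_nonneg b
  have hcs := fun y => hP.posSemidef.quad_sq_le b (A *ᵥ y)
  set β := b ⬝ᵥ P *ᵥ b with hβd
  set ζ := gainOutput K (deviation x) with hζ
  have hζ0 : ∑ i, ζ i = 0 := by
    have h1 : ∑ i, ζ i = (K *ᵥ ∑ i, deviation x i) 0 := by
      rw [Matrix.mulVec_sum, Finset.sum_apply]; rfl
    rw [h1, sum_deviation, Matrix.mulVec_zero]; rfl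
  have hdiff : ∀ i j, gainOutput K x i - gainOutput K x j = ζ i - ζ j := by
    intro i j
    simp only [hζ, gainOutput, deviation, Matrix.mulVec_sub, Pi.sub_apply]
    ring
  have hLz : G.lapMatrix ℝ *ᵥ gainOutput K x = G.lapMatrix ℝ *ᵥ ζ := by
    ext i
    simp only [lapMatrix_mulVec_eq_sum, hdiff]
  -- This is what the gain is designed for; when `β = 0` Cauchy–Schwarz makes the left side vanish
  -- as well.
  have hsζ : ∀ i, b ⬝ᵥ P *ᵥ (A *ᵥ deviation x i) = -β * ζ i := by
    intro i
    have h1 := hcs (deviation x i)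
    simp only [hζ, gainOutput, hK]
    rcases hβ.eq_or_lt with h | h
    · rw [← h] at h1 ⊢
      have : (b ⬝ᵥ P *ᵥ (A *ᵥ deviation x i)) ^ 2 = 0 :=
        le_antisymm (by linarith) (sq_nonneg _)
      simpa using this
    · field_simp
  have hspec := lapMatrix_quadratic_bound hG hlam2 hlamN h2 hN hζ0
  have hvar := sum_variance_le hs ζ
  have hmean : disagreement P (meanStep G A b α K x) =
      ∑ i, (A *ᵥ deviation x i) ⬝ᵥ P *ᵥ (A *ᵥ deviation x i) +
        β * (α ^ 2 * ((G.lapMatrix ℝ *ᵥ ζ) ⬝ᵥ (G.lapMatrix ℝ *ᵥ ζ)) -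
          2 * α * (ζ ⬝ᵥ G.lapMatrix ℝ *ᵥ ζ)) := by
    have e1 : ∀ u v : Fin N → ℝ, u ⬝ᵥ v = ∑ i, u i * v i := fun _ _ => rfl
    rw [e1, e1]
    simp only [disagreement, deviation_meanStep, quad_add_smul hP.isSymm_real, hLz, hsζ,
      Finset.mul_sum, ← Finset.sum_sub_distrib, ← Finset.sum_add_distrib]
    exact Finset.sum_congr rfl fun i _ => by ring
  have hric : disagreement P x - disagreement Q x =
      ∑ i, (A *ᵥ deviation x i) ⬝ᵥ P *ᵥ (A *ᵥ deviation x i) - (1 - δ ^ 2) * β * (ζ ⬝ᵥ ζ) := by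
    have e1 : ζ ⬝ᵥ ζ = ∑ i, ζ i * ζ i := rfl
    rw [e1]
    simp only [disagreement, Finset.mul_sum, ← Finset.sum_sub_distrib]
    refine Finset.sum_congr rfl fun i _ => ?_
    have h1 := quad_riccatiMap (A := A) (b := b) (γ := 1 - δ ^ 2) (r := 0) (Q := Q)
      hP.isSymm_real (deviation x i)
    rw [← hPe, ← hβd, hsζ, zero_add] at h1
    rw [h1]
    by_cases hb : β = 0
    · rw [hb]; ring
    · field_simp
      ring
  simp_rw [hdiff]
  rw [hmean, hric]
  have i1 := mul_le_mul_of_nonneg_left hspec hβ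
  have i2 := mul_le_mul_of_nonneg_left hvar (mul_nonneg (sq_nonneg α) hβ)
  linarith

end Disagreement

/-! ### Regrouping independent variables -/

section Independence

/-- If `U` is independent of `(V, W)` and `V` is independent of `W`, then `(U, V)` is independent
of `W`. -/
theorem ProbabilityTheory.IndepFun.prodMk_of_indepFun {Ω α β γ : Type*} [MeasurableSpace Ω]
    [MeasurableSpace α] [MeasurableSpace β] [MeasurableSpace γ] {μ : Measure Ω}
    [IsProbabilityMeasure μ] {U : Ω → α} {V : Ω → β} {W : Ω → γ} (hU : Measurable U)
    (hV : Measurable V) (hW : Measurable W) (h : IndepFun U (fun ω => (V ω, W ω)) μ)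
    (hVW : IndepFun V W μ) : IndepFun (fun ω => (U ω, V ω)) W μ := by
  have hUV : IndepFun U V μ := h.comp measurable_id measurable_fst
  have := Measure.isProbabilityMeasure_map (μ := μ) hU.aemeasurable
  have := Measure.isProbabilityMeasure_map (μ := μ) hV.aemeasurable
  have := Measure.isProbabilityMeasure_map (μ := μ) hW.aemeasurable
  rw [indepFun_iff_map_prod_eq_prod_map_map (hU.prodMk hV).aemeasurable hW.aemeasurable,
    hUV.map_prod_eq_prod_map_map hU.aemeasurable hV.aemeasurable]
  have h1 := h.map_prod_eq_prod_map_map hU.aemeasurable (hV.prodMk hW).aemeasurable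
  rw [hVW.map_prod_eq_prod_map_map hV.aemeasurable hW.aemeasurable] at h1
  have h2 : (fun ω => ((U ω, V ω), W ω)) =
      MeasurableEquiv.prodAssoc.symm ∘ fun ω => (U ω, (V ω, W ω)) := rfl
  rw [h2, ← Measure.map_map (MeasurableEquiv.measurable _) (hU.prodMk (hV.prodMk hW)), h1]
  have h3 := Measure.prodAssoc_prod (μ := μ.map U) (ν := μ.map V) (τ := μ.map W)
  rw [← h3, Measure.map_map (MeasurableEquiv.measurable _) (MeasurableEquiv.measurable _)]
  simp

end Independence

/-! ### Second moments of multiplicative noise -/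

section Noise

variable {Ω ι S : Type*} [MeasurableSpace Ω] [Fintype ι] [MeasurableSpace S] {μ : Measure Ω}

/-- A product of square-integrable functions is in general only integrable; independence of the
squares is what keeps it in `L²`. -/
theorem memLp_mul_of_indepFun {f g : Ω → ℝ} (hf : MemLp f 2 μ) (hg : MemLp g 2 μ)
    (h : IndepFun f g μ) : MemLp (fun ω => f ω * g ω) 2 μ := by
  refine (memLp_two_iff_integrable_sq (hf.1.mul hg.1)).mpr ?_
  simp only [Pi.mul_apply, mul_pow]
  exact (h.comp (φ := fun x => x ^ 2) (ψ := fun x => x ^ 2) (by fun_prop)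
    (by fun_prop)).integrable_mul hf.integrable_sq hg.integrable_sq

/-- Zero-mean uncorrelated noises `D`, jointly independent of `X`, acting on functions of `X`. -/
theorem noise_sum_moments {X : Ω → S} {D : ι → Ω → ℝ} {v : ι → ℝ} {g : ι → S → ℝ} {h : S → ℝ}
    (hD : ∀ j, MemLp (D j) 2 μ) (hmean : ∀ j, ∫ ω, D j ω ∂μ = 0)
    (hvar : ∀ j, ∫ ω, D j ω ^ 2 ∂μ = v j) (hcov : ∀ j l, j ≠ l → ∫ ω, D j ω * D l ω ∂μ = 0)
    (hind : IndepFun (fun ω j => D j ω) X μ) (hg : ∀ j, Measurable (g j)) (hh : Measurable h)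
    (hgL : ∀ j, MemLp (fun ω => g j (X ω)) 2 μ) (hhL : MemLp (fun ω => h (X ω)) 2 μ) :
    MemLp (fun ω => ∑ j, D j ω * g j (X ω)) 2 μ ∧
    ∫ ω, (∑ j, D j ω * g j (X ω)) * h (X ω) ∂μ = 0 ∧
    ∫ ω, (∑ j, D j ω * g j (X ω)) ^ 2 ∂μ = ∑ j, v j * ∫ ω, g j (X ω) ^ 2 ∂μ := by
  have hDg : ∀ j, MemLp (fun ω => D j ω * g j (X ω)) 2 μ := fun j =>
    memLp_mul_of_indepFun (hD j) (hgL j)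
      (hind.comp (φ := fun d : ι → ℝ => d j) (ψ := g j) (measurable_pi_apply j) (hg j))
  refine ⟨memLp_finsetSum _ fun j _ => hDg j, ?_, ?_⟩
  · have hint : ∀ j, Integrable (fun ω => D j ω * g j (X ω) * h (X ω)) μ := fun j =>
      (hDg j).integrable_mul hhL
    simp_rw [Finset.sum_mul]
    rw [integral_finsetSum _ fun j _ => hint j]
    refine Finset.sum_eq_zero fun j _ => ?_
    have h1 : IndepFun (D j) (fun ω => g j (X ω) * h (X ω)) μ :=
      hind.comp (φ := fun d : ι → ℝ => d j) (ψ := fun x => g j x * h x) (measurable_pi_apply j)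
        ((hg j).mul hh)
    simp_rw [mul_assoc]
    rw [h1.integral_fun_mul_eq_mul_integral (hD j).1 ((hgL j).1.mul hhL.1), hmean, zero_mul]
  · have hint : ∀ j l, Integrable (fun ω => D j ω * g j (X ω) * (D l ω * g l (X ω))) μ :=
      fun j l => (hDg j).integrable_mul (hDg l)
    simp_rw [pow_two, Finset.sum_mul_sum]
    rw [integral_finsetSum _ fun j _ => integrable_finsetSum _ fun l _ => hint j l]
    refine Finset.sum_congr rfl fun j _ => ?_
    rw [integral_finsetSum _ fun l _ => hint j l]
    have h1 : ∀ l, ∫ ω, D j ω * g j (X ω) * (D l ω * g l (X ω)) ∂μ =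
        (∫ ω, D j ω * D l ω ∂μ) * ∫ ω, g j (X ω) * g l (X ω) ∂μ := by
      intro l
      have h2 : IndepFun (fun ω => D j ω * D l ω) (fun ω => g j (X ω) * g l (X ω)) μ :=
        hind.comp (φ := fun d : ι → ℝ => d j * d l) (ψ := fun x => g j x * g l x)
          ((measurable_pi_apply j).mul (measurable_pi_apply l)) ((hg j).mul (hg l))
      rw [← h2.integral_fun_mul_eq_mul_integral ((hD j).1.mul (hD l).1) ((hgL j).1.mul (hgL l).1)]
      exact integral_congr_ae (Eventually.of_forall fun ω => by ring)
    simp_rw [h1]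
    rw [Finset.sum_eq_single_of_mem j (Finset.mem_univ j) fun l _ hl => by
      rw [hcov j l hl.symm, zero_mul]]
    rw [← hvar j]
    simp_rw [pow_two]

end Noise

/-! ### Square integrability of derived quantities -/

section SquareIntegrable

variable {Ω : Type*} [MeasurableSpace Ω] {μ : Measure Ω} {m n : ℕ}

theorem memLp_dotProduct (c : Fin n → ℝ) {v : Ω → Fin n → ℝ}
    (hv : ∀ a, MemLp (fun ω => v ω a) 2 μ) : MemLp (fun ω => c ⬝ᵥ v ω) 2 μ :=
  memLp_finsetSum _ fun a _ => (hv a).const_mul (c a)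

theorem memLp_mulVec (M : Matrix (Fin m) (Fin n) ℝ) {v : Ω → Fin n → ℝ}
    (hv : ∀ a, MemLp (fun ω => v ω a) 2 μ) (a : Fin m) : MemLp (fun ω => (M *ᵥ v ω) a) 2 μ :=
  memLp_dotProduct (M a) hv

theorem integrable_quad (P : Matrix (Fin n) (Fin n) ℝ) {v : Ω → Fin n → ℝ}
    (hv : ∀ a, MemLp (fun ω => v ω a) 2 μ) : Integrable (fun ω => v ω ⬝ᵥ P *ᵥ v ω) μ :=
  integrable_finsetSum _ fun a _ => (hv a).integrable_mul (memLp_mulVec P hv a)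

variable {N : ℕ} {x : Ω → Fin N → Fin n → ℝ}

theorem memLp_deviation (hx : ∀ i a, MemLp (fun ω => x ω i a) 2 μ) (i : Fin N) (a : Fin n) :
    MemLp (fun ω => deviation (x ω) i a) 2 μ := by
  simp only [deviation, Pi.sub_apply, Pi.smul_apply, Finset.sum_apply, smul_eq_mul]
  exact (hx i a).sub ((memLp_finsetSum _ fun j _ => hx j a).const_mul _)

theorem integrable_disagreement (P : Matrix (Fin n) (Fin n) ℝ)
    (hx : ∀ i a, MemLp (fun ω => x ω i a) 2 μ) : Integrable (fun ω => disagreement P (x ω)) μ :=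
  integrable_finsetSum _ fun i _ => integrable_quad P (memLp_deviation hx i)

theorem memLp_gainOutput (K : Matrix (Fin 1) (Fin n) ℝ)
    (hx : ∀ i a, MemLp (fun ω => x ω i a) 2 μ) (i : Fin N) :
    MemLp (fun ω => gainOutput K (x ω) i) 2 μ := memLp_mulVec K (hx i) 0

theorem memLp_meanStep (G : SimpleGraph (Fin N)) [DecidableRel G.Adj]
    (A : Matrix (Fin n) (Fin n) ℝ) (b : Fin n → ℝ) (α : ℝ) (K : Matrix (Fin 1) (Fin n) ℝ)
    (hx : ∀ i a, MemLp (fun ω => x ω i a) 2 μ) (i : Fin N) (a : Fin n) :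
    MemLp (fun ω => meanStep G A b α K (x ω) i a) 2 μ := by
  simp only [meanStep, Pi.add_apply, Pi.smul_apply, smul_eq_mul]
  exact (memLp_mulVec A (hx i) a).add
    (((memLp_mulVec _ (memLp_gainOutput K hx) i).const_mul α).mul_const (b a))

end SquareIntegrable

/-! ### The closed loop: measurability and independence from current noise -/

section ClosedLoop

theorem agentState_succ {N n : ℕ} {Ω : Type*} (G : SimpleGraph (Fin N)) [DecidableRel G.Adj]
    (A : Matrix (Fin n) (Fin n) ℝ) (B : Matrix (Fin n) (Fin 1) ℝ) (α : ℝ)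
    (K : Matrix (Fin 1) (Fin n) ℝ) (Δ : Fin N → Fin N → ℕ → Ω → ℝ) (x₀ : Ω → Fin N → Fin n → ℝ)
    (k : ℕ) (ω : Ω) (i : Fin N) :
    agentState G A B α K Δ x₀ (k + 1) ω i =
      meanStep G A (fun a => B a 0) α K (agentState G A B α K Δ x₀ k ω) i +
        (α * noiseInput K (fun i j => G.adjMatrix ℝ i j * Δ i j k ω)
          (agentState G A B α K Δ x₀ k ω) i) • fun a => B a 0 :=
  step_eq G A B α K _ _ i

variable {N n : ℕ} {Ω : Type*} [MeasurableSpace Ω] {G : SimpleGraph (Fin N)} [DecidableRel G.Adj]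
  {A : Matrix (Fin n) (Fin n) ℝ} {B : Matrix (Fin n) (Fin 1) ℝ} {σ : Fin N → Fin N → ℝ} {α : ℝ}
  {K : Matrix (Fin 1) (Fin n) ℝ} {Δ : Fin N → Fin N → ℕ → Ω → ℝ} {x₀ : Ω → Fin N → Fin n → ℝ}

theorem measurable_weighted_noise {k : ℕ} (hΔ : ∀ i j, G.Adj i j → Measurable (Δ i j k))
    (i j : Fin N) : Measurable fun ω => G.adjMatrix ℝ i j * Δ i j k ω := by
  by_cases h : G.Adj i j
  · exact (hΔ i j h).const_mul _
  · simp [h]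

theorem continuous_gainOutput (K : Matrix (Fin 1) (Fin n) ℝ) :
    Continuous fun x : Fin N → Fin n → ℝ => gainOutput K x := by
  unfold gainOutput
  fun_prop

theorem continuous_deviation :
    Continuous fun x : Fin N → Fin n → ℝ => deviation x := by
  unfold deviation
  fun_prop

theorem continuous_meanStep (G : SimpleGraph (Fin N)) [DecidableRel G.Adj]
    (A : Matrix (Fin n) (Fin n) ℝ) (b : Fin n → ℝ) (α : ℝ) (K : Matrix (Fin 1) (Fin n) ℝ) :
    Continuous fun x : Fin N → Fin n → ℝ => meanStep G A b α K x := by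
  unfold meanStep
  have := continuous_gainOutput (N := N) K
  fun_prop

/-- Only the noises before time `k` enter, and the σ-algebra on `Ω` is arbitrary; both matter for
independence, where it is the one generated by the initial state and the past noises. -/
theorem measurable_agentState {k : ℕ} (hx₀ : Measurable x₀)
    (hΔ : ∀ l < k, ∀ i j, G.Adj i j → Measurable (Δ i j l)) :
    Measurable (agentState G A B α K Δ x₀ k) := by
  induction k with
  | zero => exact hx₀
  | succ k ih =>
    have hx := ih fun l hl => hΔ l (hl.trans k.lt_succ_self)
    have hn := measurable_weighted_noise (hΔ k k.lt_succ_self)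
    refine measurable_pi_iff.mpr fun i => ?_
    have h1 : Measurable fun ω => meanStep G A (fun a => B a 0) α K
        (agentState G A B α K Δ x₀ k ω) i :=
      (measurable_pi_apply i).comp ((continuous_meanStep G A _ α K).measurable.comp hx)
    have hz : ∀ j, Measurable fun ω => gainOutput K (agentState G A B α K Δ x₀ k ω) j := fun j =>
      (measurable_pi_apply j).comp ((continuous_gainOutput K).measurable.comp hx)
    have h2 : Measurable fun ω => noiseInput K (fun i j => G.adjMatrix ℝ i j * Δ i j k ω)
        (agentState G A B α K Δ x₀ k ω) i :=
      Finset.measurable_sum _ fun j _ => (hn i j).mul ((hz i).sub (hz j))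
    simp_rw [agentState_succ]
    exact h1.add ((h2.const_mul α).smul_const _)

variable {μ : Measure Ω} [IsProbabilityMeasure μ]

/-- The state at time `k` is independent of the noises at time `k`. -/
theorem indepFun_noise_agentState (hΔ : IsChannelNoise μ G σ Δ) (hx₀ : IsInitialState μ G Δ x₀)
    (k : ℕ) : IndepFun (fun ω i j => G.adjMatrix ℝ i j * Δ i j k ω)
      (agentState G A B α K Δ x₀ k) μ := by
  classical
  let Y : G.Dart × ℕ → Ω → ℝ := fun e => Δ e.1.fst e.1.snd e.2
  have hY : ∀ e, Measurable (Y e) := fun e => hΔ.measurable _ _ e.1.adj _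
  let S : Finset (G.Dart × ℕ) := Finset.univ ×ˢ Finset.range k
  let T : Finset (G.Dart × ℕ) := Finset.univ ×ˢ {k}
  have hST : Disjoint S T := by
    rw [Finset.disjoint_left]
    intro e he he'
    simp only [S, T, Finset.mem_product, Finset.mem_range, Finset.mem_singleton] at he he'
    omega
  have hVW := hΔ.indep.indepFun_finset S T hST hY
  have hV : Measurable fun ω (e : S) => Y e ω := measurable_pi_lambda _ fun e => hY e
  have hW : Measurable fun ω (e : T) => Y e ω := measurable_pi_lambda _ fun e => hY e
  have hU : IndepFun x₀ (fun ω => ((fun e : S => Y e ω), (fun e : T => Y e ω))) μ :=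
    hx₀.indep.comp (φ := id)
      (ψ := fun d : G.Dart × ℕ → ℝ => ((fun e : S => d e), (fun e : T => d e))) measurable_id
      (by fun_prop)
  have hind := hU.prodMk_of_indepFun hx₀.measurable hV hW hVW
  have hnoise : IndepFun (fun ω => (x₀ ω, fun e : S => Y e ω))
      (fun ω i j => G.adjMatrix ℝ i j * Δ i j k ω) μ := by
    -- Off the edges `Δ` is unconstrained, possibly not even measurable; the adjacency weight makes
    -- these entries zero.
    let ψ : (T → ℝ) → Fin N → Fin N → ℝ := fun d i j =>
      if h : G.Adj i j then d ⟨(⟨(i, j), h⟩, k), by simp [T]⟩ else 0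
    have hψ : Measurable ψ := by
      refine measurable_pi_lambda _ fun i => measurable_pi_lambda _ fun j => ?_
      by_cases h : G.Adj i j
      · simp only [ψ, h, dite_true]
        exact measurable_pi_apply _
      · simp only [ψ, h, dite_false]
        exact measurable_const
    have h1 := hind.comp measurable_id hψ
    have h2 : (ψ ∘ fun ω (e : T) => Y e ω) = fun ω i j => G.adjMatrix ℝ i j * Δ i j k ω := by
      ext ω i j
      by_cases h : G.Adj i j
      · simp [ψ, Y, h]
      · simp [ψ, h]
    rw [h2] at h1
    exact h1
  refine IndepFun.symm ?_
  -- Measurability with respect to the σ-algebra of the initial state and the past transfers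
  -- independence to the state at time `k`.
  have hm : @Measurable Ω _ (MeasurableSpace.comap (fun ω => (x₀ ω, fun e : S => Y e ω))
      inferInstance) _ (agentState G A B α K Δ x₀ k) := by
    have hp : @Measurable Ω _ (MeasurableSpace.comap (fun ω => (x₀ ω, fun e : S => Y e ω))
      inferInstance) _ (fun ω => (x₀ ω, fun e : S => Y e ω)) := comap_measurable _
    refine @measurable_agentState N n Ω (MeasurableSpace.comap _ _) G _ A B α K Δ x₀ k
      (measurable_fst.comp hp) fun l hl i j hij => ?_
    have hmem : ((⟨(i, j), hij⟩, l) : G.Dart × ℕ) ∈ S := by simp [S, hl]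
    exact (measurable_pi_apply (⟨_, hmem⟩ : S)).comp (measurable_snd.comp hp)
  exact indep_of_indep_of_le_left hnoise hm.comap_le

end ClosedLoop

/-! ### One step in mean square -/

section MeanSquare

variable {N n : ℕ} {Ω : Type*} [MeasurableSpace Ω] {G : SimpleGraph (Fin N)} [DecidableRel G.Adj]
  {A : Matrix (Fin n) (Fin n) ℝ} {B : Matrix (Fin n) (Fin 1) ℝ} {σ : Fin N → Fin N → ℝ} {α : ℝ}
  {K : Matrix (Fin 1) (Fin n) ℝ} {Δ : Fin N → Fin N → ℕ → Ω → ℝ} {x₀ : Ω → Fin N → Fin n → ℝ}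
  {μ : Measure Ω} [IsProbabilityMeasure μ]

/-- Second moments of the noise input of an agent. -/
theorem noiseInput_moments (hΔ : IsChannelNoise μ G σ Δ) (hx₀ : IsInitialState μ G Δ x₀) {k : ℕ}
    (hx : ∀ i a, MemLp (fun ω => agentState G A B α K Δ x₀ k ω i a) 2 μ)
    {h : (Fin N → Fin n → ℝ) → ℝ} (hh : Measurable h)
    (hhL : MemLp (fun ω => h (agentState G A B α K Δ x₀ k ω)) 2 μ) (i : Fin N) :
    MemLp (fun ω => noiseInput K (fun i j => G.adjMatrix ℝ i j * Δ i j k ω)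
      (agentState G A B α K Δ x₀ k ω) i) 2 μ ∧
    ∫ ω, noiseInput K (fun i j => G.adjMatrix ℝ i j * Δ i j k ω)
      (agentState G A B α K Δ x₀ k ω) i * h (agentState G A B α K Δ x₀ k ω) ∂μ = 0 ∧
    ∫ ω, noiseInput K (fun i j => G.adjMatrix ℝ i j * Δ i j k ω)
      (agentState G A B α K Δ x₀ k ω) i ^ 2 ∂μ = ∑ j, G.adjMatrix ℝ i j * σ i j ^ 2 *
        ∫ ω, (gainOutput K (agentState G A B α K Δ x₀ k ω) i -
          gainOutput K (agentState G A B α K Δ x₀ k ω) j) ^ 2 ∂μ := by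
  have hz : ∀ j, Measurable fun x : Fin N → Fin n → ℝ => gainOutput K x j := fun j =>
    (measurable_pi_apply j).comp (continuous_gainOutput K).measurable
  have hL := memLp_gainOutput K hx
  refine noise_sum_moments (X := agentState G A B α K Δ x₀ k)
    (D := fun j ω => G.adjMatrix ℝ i j * Δ i j k ω)
    (g := fun j x => gainOutput K x i - gainOutput K x j)
    (fun j => ?_) (fun j => ?_) (fun j => ?_) (fun j l hjl => ?_) ?_
    (fun j => (hz i).sub (hz j)) hh (fun j => (hL i).sub (hL j)) hhL
  · by_cases hij : G.Adj i j
    · exact (hΔ.memLp i j hij k).const_mul _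
    · simp [hij]
  · by_cases hij : G.Adj i j
    · rw [integral_const_mul, hΔ.mean i j hij k, mul_zero]
    · simp [hij]
  · by_cases hij : G.Adj i j
    · simpa [hij] using hΔ.sq_mean i j hij k
    · simp [hij]
  · by_cases hij : G.Adj i j
    · by_cases hil : G.Adj i l
      · have hne : ((⟨(i, j), hij⟩, k) : G.Dart × ℕ) ≠ (⟨(i, l), hil⟩, k) := by
          simp [SimpleGraph.Dart.ext_iff, hjl]
        have h1 : IndepFun (Δ i j k) (Δ i l k) μ := hΔ.indep.indepFun hne
        have h2 := h1.integral_fun_mul_eq_mul_integral (hΔ.memLp i j hij k).1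
          (hΔ.memLp i l hil k).1
        rw [hΔ.mean i j hij k, zero_mul] at h2
        simpa [hij, hil] using h2
      · simp [hil]
    · simp [hij]
  · exact (indepFun_noise_agentState hΔ hx₀ k).comp (φ := fun d : Fin N → Fin N → ℝ => d i)
      (measurable_pi_apply i) measurable_id

theorem memLp_agentState (hΔ : IsChannelNoise μ G σ Δ) (hx₀ : IsInitialState μ G Δ x₀) (k : ℕ) :
    ∀ i a, MemLp (fun ω => agentState G A B α K Δ x₀ k ω i a) 2 μ := by
  induction k with
  | zero => exact hx₀.memLp
  | succ k ih =>
    intro i a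
    -- Only square integrability is needed here, so the test function is a dummy.
    have h1 := (noiseInput_moments hΔ hx₀ ih (h := fun _ => 0) measurable_const
      (memLp_const 0) i).1
    simp only [agentState_succ, Pi.add_apply, Pi.smul_apply, smul_eq_mul]
    exact (memLp_meanStep G A _ α K ih i a).add ((h1.const_mul α).mul_const _)

/-- One step of the closed loop in mean square. -/
theorem integral_disagreement_succ_le {P : Matrix (Fin n) (Fin n) ℝ} (hP : P.PosSemidef)
    (hΔ : IsChannelNoise μ G σ Δ) (hx₀ : IsInitialState μ G Δ x₀) (k : ℕ) :
    ∫ ω, disagreement P (agentState G A B α K Δ x₀ (k + 1) ω) ∂μ ≤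
      ∫ ω, (disagreement P (meanStep G A (fun a => B a 0) α K (agentState G A B α K Δ x₀ k ω)) +
        α ^ 2 * ((fun a => B a 0) ⬝ᵥ P *ᵥ fun a => B a 0) *
          ∑ i, ∑ j, G.adjMatrix ℝ i j * σ i j ^ 2 *
            (gainOutput K (agentState G A B α K Δ x₀ k ω) i -
              gainOutput K (agentState G A B α K Δ x₀ k ω) j) ^ 2) ∂μ := by
  set b : Fin n → ℝ := fun a => B a 0 with hb
  set X := agentState G A B α K Δ x₀ k with hX
  have hx : ∀ i a, MemLp (fun ω => X ω i a) 2 μ := memLp_agentState hΔ hx₀ k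
  have hm : ∀ i a, MemLp (fun ω => meanStep G A b α K (X ω) i a) 2 μ :=
    memLp_meanStep G A b α K hx
  -- The coefficient of the noise in the cross term depends on the current state alone, so the cross
  -- term has mean zero.
  let h : Fin N → (Fin N → Fin n → ℝ) → ℝ := fun i x =>
    b ⬝ᵥ P *ᵥ deviation (meanStep G A b α K x) i
  have hh : ∀ i, Measurable (h i) := by
    intro i
    have h1 : Continuous fun x : Fin N → Fin n → ℝ => deviation (meanStep G A b α K x) :=
      continuous_deviation.comp (continuous_meanStep G A b α K)
    have h2 : Continuous (h i) := by
      simp only [h]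
      fun_prop
    exact h2.measurable
  have hhL : ∀ i, MemLp (fun ω => h i (X ω)) 2 μ := fun i =>
    memLp_dotProduct b (memLp_mulVec P (memLp_deviation hm i))
  set w : Ω → Fin N → ℝ := fun ω =>
    noiseInput K (fun i j => G.adjMatrix ℝ i j * Δ i j k ω) (X ω) with hw
  have hmom : ∀ i, MemLp (fun ω => w ω i) 2 μ ∧ ∫ ω, w ω i * h i (X ω) ∂μ = 0 ∧
      ∫ ω, w ω i ^ 2 ∂μ = ∑ j, G.adjMatrix ℝ i j * σ i j ^ 2 *
        ∫ ω, (gainOutput K (X ω) i - gainOutput K (X ω) j) ^ 2 ∂μ := fun i =>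
    noiseInput_moments hΔ hx₀ hx (hh i) (hhL i) i
  have hwh : ∀ i, Integrable (fun ω => w ω i * h i (X ω)) μ := fun i =>
    (hmom i).1.integrable_mul (hhL i)
  have hw2 : ∀ i, Integrable (fun ω => w ω i ^ 2) μ := fun i => (hmom i).1.integrable_sq
  have hz2 : ∀ i j, Integrable
      (fun ω => (gainOutput K (X ω) i - gainOutput K (X ω) j) ^ 2) μ := fun i j =>
    ((memLp_gainOutput K hx i).sub (memLp_gainOutput K hx j)).integrable_sq
  have hstep : ∀ ω, disagreement P (agentState G A B α K Δ x₀ (k + 1) ω) ≤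
      disagreement P (meanStep G A b α K (X ω)) + 2 * α * ∑ i, w ω i * h i (X ω) +
        α ^ 2 * (b ⬝ᵥ P *ᵥ b) * ∑ i, w ω i ^ 2 := by
    intro ω
    have h1 : agentState G A B α K Δ x₀ (k + 1) ω =
        fun i => meanStep G A b α K (X ω) i + (α * w ω i) • b :=
      funext fun i => agentState_succ G A B α K Δ x₀ k ω i
    rw [h1]
    exact disagreement_step_le hP (w ω) _
  have i0 : Integrable (fun ω => disagreement P (meanStep G A b α K (X ω))) μ :=
    integrable_disagreement P hm
  have i1 : Integrable (fun ω => 2 * α * ∑ i, w ω i * h i (X ω)) μ :=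
    (integrable_finsetSum _ fun i _ => hwh i).const_mul _
  have i2 : Integrable (fun ω => α ^ 2 * (b ⬝ᵥ P *ᵥ b) * ∑ i, w ω i ^ 2) μ :=
    (integrable_finsetSum _ fun i _ => hw2 i).const_mul _
  have i3 : ∀ i, Integrable (fun ω => ∑ j, G.adjMatrix ℝ i j * σ i j ^ 2 *
      (gainOutput K (X ω) i - gainOutput K (X ω) j) ^ 2) μ := fun i =>
    integrable_finsetSum _ fun j _ => (hz2 i j).const_mul _
  have i4 : Integrable (fun ω => α ^ 2 * (b ⬝ᵥ P *ᵥ b) * ∑ i, ∑ j, G.adjMatrix ℝ i j * σ i j ^ 2 *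
      (gainOutput K (X ω) i - gainOutput K (X ω) j) ^ 2) μ :=
    (integrable_finsetSum _ fun i _ => i3 i).const_mul _
  refine (integral_mono (integrable_disagreement P (memLp_agentState hΔ hx₀ (k + 1)))
    ((i0.add i1).add i2) hstep).trans (le_of_eq ?_)
  have e1 : ∫ ω, 2 * α * ∑ i, w ω i * h i (X ω) ∂μ = 0 := by
    rw [integral_const_mul, integral_finsetSum _ fun i _ => hwh i,
      Finset.sum_eq_zero fun i _ => (hmom i).2.1, mul_zero]
  have e2 : ∫ ω, α ^ 2 * (b ⬝ᵥ P *ᵥ b) * ∑ i, w ω i ^ 2 ∂μ =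
      ∫ ω, α ^ 2 * (b ⬝ᵥ P *ᵥ b) * ∑ i, ∑ j, G.adjMatrix ℝ i j * σ i j ^ 2 *
        (gainOutput K (X ω) i - gainOutput K (X ω) j) ^ 2 ∂μ := by
    rw [integral_const_mul, integral_const_mul, integral_finsetSum _ fun i _ => hw2 i,
      integral_finsetSum _ fun i _ => i3 i]
    congr 1
    refine Finset.sum_congr rfl fun i _ => ?_
    rw [(hmom i).2.2, integral_finsetSum _ fun j _ => (hz2 i j).const_mul _]
    exact Finset.sum_congr rfl fun j _ => (integral_const_mul _ _).symm
  have e3 := integral_add (i0.add i1) i2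
  have e4 := integral_add i0 i1
  have e5 := integral_add i0 i4
  simp only [Pi.add_apply] at e3 e4 e5 ⊢
  rw [e3, e4, e5, e1, e2, add_zero]

end MeanSquare

/-! ### Geometric decay and consensus -/

section Consensus

variable {N n : ℕ}

theorem disagreement_nonneg {P : Matrix (Fin n) (Fin n) ℝ} (hP : P.PosSemidef)
    (x : Fin N → Fin n → ℝ) : 0 ≤ disagreement P x :=
  Finset.sum_nonneg fun _ _ => hP.quad_nonneg _

theorem disagreement_le_mul {P Q : Matrix (Fin n) (Fin n) ℝ} {C : ℝ}
    (h : ∀ x : Fin n → ℝ, x ⬝ᵥ P *ᵥ x ≤ C * (x ⬝ᵥ Q *ᵥ x)) (x : Fin N → Fin n → ℝ) :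
    disagreement P x ≤ C * disagreement Q x := by
  rw [disagreement, disagreement, Finset.mul_sum]
  exact Finset.sum_le_sum fun i _ => h _

theorem norm_sub_sq_le_disagreement (x : Fin N → Fin n → ℝ) (i j : Fin N) :
    ‖WithLp.toLp 2 (x i - x j)‖ ^ 2 ≤ 4 * disagreement 1 x := by
  have h0 : ∀ v : Fin n → ℝ, ‖WithLp.toLp 2 v‖ ^ 2 = v ⬝ᵥ v := fun v => by
    rw [EuclideanSpace.real_norm_sq_eq]
    simp [dotProduct, pow_two]
  have h1 : WithLp.toLp 2 (x i - x j) =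
      WithLp.toLp 2 (deviation x i) - WithLp.toLp 2 (deviation x j) := by
    rw [← WithLp.toLp_sub]
    congr 1
    simp only [deviation]
    abel
  have h2 : ∀ l, ‖WithLp.toLp 2 (deviation x l)‖ ^ 2 ≤ disagreement 1 x := by
    intro l
    rw [h0, disagreement]
    simp only [Matrix.one_mulVec]
    exact Finset.single_le_sum (f := fun l => deviation x l ⬝ᵥ deviation x l)
      (fun m _ => Finset.sum_nonneg fun a _ => mul_self_nonneg _) (Finset.mem_univ l)
  rw [h1]
  have h3 := norm_sub_le (WithLp.toLp 2 (deviation x i)) (WithLp.toLp 2 (deviation x j))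
  have h4 := pow_le_pow_left₀ (norm_nonneg _) h3 2
  have h5 := two_mul_le_add_sq ‖WithLp.toLp 2 (deviation x i)‖ ‖WithLp.toLp 2 (deviation x j)‖
  have h6 := h2 i
  have h7 := h2 j
  nlinarith

/-- The gain of a solution of the modified algebraic Riccati equation reaches consensus. -/
theorem solvesMeanSquareConsensus_mareGain {G : SimpleGraph (Fin N)} [DecidableRel G.Adj]
    (hG : G.Connected) {A P Q : Matrix (Fin n) (Fin n) ℝ} {B : Matrix (Fin n) (Fin 1) ℝ}
    {σ : Fin N → Fin N → ℝ} {α lam2 lamN s δ : ℝ} (hs : s ∈ upperBounds (edgeVariances G σ))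
    (hlam2 : IsLeast (nonzeroLapEigenvalues G) lam2)
    (hlamN : IsGreatest (nonzeroLapEigenvalues G) lamN)
    (h2 : (α * lam2 - 1) ^ 2 + α ^ 2 * s * lam2 ≤ δ ^ 2)
    (hN : (α * lamN - 1) ^ 2 + α ^ 2 * s * lamN ≤ δ ^ 2)
    (hQ : Q.PosDef) (hP : P.PosDef) (hPe : SolvesMARE A B Q δ P) :
    SolvesMeanSquareConsensus.{u} G A B σ α (mareGain A B P) := by
  intro Ω _ μ _ Δ x₀ hΔ hx₀ i j
  rw [solvesMARE_iff hP.isSymm_real] at hPe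
  set X := agentState G A B α (mareGain A B P) Δ x₀ with hX
  have hL : ∀ k i a, MemLp (fun ω => X k ω i a) 2 μ := memLp_agentState hΔ hx₀
  obtain ⟨C, hC0, hC⟩ := exists_quad_le_mul P hQ
  obtain ⟨D, hD0, hD⟩ := exists_quad_le_mul (1 : Matrix (Fin n) (Fin n) ℝ) hP
  -- From `P ≤ C Q`, removing `Q` removes at least the fraction `(C + 1)⁻¹` of `P`; the `+ 1`
  -- guarantees `ρ ≥ 0`.
  set ρ := 1 - (C + 1)⁻¹ with hρ
  have hinv : (C + 1)⁻¹ ≤ 1 := inv_le_one_of_one_le₀ (by linarith)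
  have hinv0 : 0 < (C + 1)⁻¹ := by positivity
  have hdec : ∀ k, ∫ ω, disagreement P (X (k + 1) ω) ∂μ ≤
      ρ * ∫ ω, disagreement P (X k ω) ∂μ := by
    intro k
    refine (integral_disagreement_succ_le hP.posSemidef hΔ hx₀ k).trans ?_
    rw [← integral_const_mul]
    refine integral_mono_of_nonneg (Eventually.of_forall fun ω => ?_)
      ((integrable_disagreement P (hL k)).const_mul ρ) (Eventually.of_forall fun ω => ?_)
    · refine add_nonneg (disagreement_nonneg hP.posSemidef _) (mul_nonneg
        (mul_nonneg (sq_nonneg _) (hP.posSemidef.quad_nonneg _)) (Finset.sum_nonneg fun i _ =>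
          Finset.sum_nonneg fun j _ => mul_nonneg (mul_nonneg ?_ (sq_nonneg _)) (sq_nonneg _)))
      rw [SimpleGraph.adjMatrix_apply]
      split_ifs <;> norm_num
    · refine (disagreement_meanStep_add_noise_le hG hs hlam2 hlamN h2 hN hP hPe
        (mareGain_mulVec A P B) (X k ω)).trans ?_
      have h1 := disagreement_le_mul hC (X k ω)
      have h3 := disagreement_nonneg hQ.posSemidef (X k ω)
      have h4 : (C + 1)⁻¹ * disagreement P (X k ω) ≤ disagreement Q (X k ω) := by
        rw [inv_mul_le_iff₀ (by positivity)]
        linarith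
      simp only [hρ]
      linarith
  have hpow : ∀ k, ∫ ω, disagreement P (X k ω) ∂μ ≤
      ρ ^ k * ∫ ω, disagreement P (X 0 ω) ∂μ := by
    intro k
    induction k with
    | zero => simp
    | succ k ih =>
      have h1 := mul_le_mul_of_nonneg_left ih (show 0 ≤ ρ by linarith)
      rw [pow_succ', mul_assoc]
      exact (hdec k).trans h1
  have hbound : ∀ k ω, ‖WithLp.toLp 2 (X k ω i - X k ω j)‖ ^ 2 ≤
      4 * D * disagreement P (X k ω) := by
    intro k ω
    have h1 := norm_sub_sq_le_disagreement (X k ω) i j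
    have h3 := disagreement_le_mul hD (X k ω)
    linarith
  have hint : ∀ k, Integrable (fun ω => 4 * D * disagreement P (X k ω)) μ := fun k =>
    (integrable_disagreement P (hL k)).const_mul _
  refine ⟨fun k => ?_, ?_⟩
  · simp only [EuclideanSpace.real_norm_sq_eq]
    exact integrable_finsetSum _ fun a _ => ((hL k i a).sub (hL k j a)).integrable_sq
  · have hlim : Tendsto (fun k => 4 * D * (ρ ^ k * ∫ ω, disagreement P (X 0 ω) ∂μ)) atTop
        (𝓝 0) := by
      have := tendsto_pow_atTop_nhds_zero_of_lt_one (show 0 ≤ ρ by linarith)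
        (show ρ < 1 by linarith)
      simpa using (this.mul_const (∫ ω, disagreement P (X 0 ω) ∂μ)).const_mul (4 * D)
    refine squeeze_zero (fun k => integral_nonneg fun ω => by positivity) (fun k => ?_) hlim
    refine (integral_mono_of_nonneg (Eventually.of_forall fun ω => by positivity) (hint k)
      (Eventually.of_forall fun ω => hbound k ω)).trans ?_
    rw [integral_const_mul]
    exact mul_le_mul_of_nonneg_left (hpow k) (by positivity)

end Consensus

/-! ### The main theorem -/

theorem theorem1 {N n : ℕ} (hN : 2 ≤ N)
    (G : SimpleGraph (Fin N)) [DecidableRel G.Adj] (hG : G.Connected)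
    (A : Matrix (Fin n) (Fin n) ℝ) (B : Matrix (Fin n) (Fin 1) ℝ) (hAB : IsStabilizable A B)
    (σ : Fin N → Fin N → ℝ) (sMax : ℝ) (hsMax : IsGreatest (edgeVariances G σ) sMax)
    (lam2 lamN : ℝ) (hlam2 : IsLeast (nonzeroLapEigenvalues G) lam2)
    (hlamN : IsGreatest (nonzeroLapEigenvalues G) lamN)
    (α : ℝ) (hα : 0 < α)
    (h2 : (α * lam2 - 1) ^ 2 + α ^ 2 * sMax * lam2 < 1 / matrixMahlerMeasure A ^ 2)
    (hN' : (α * lamN - 1) ^ 2 + α ^ 2 * sMax * lamN < 1 / matrixMahlerMeasure A ^ 2) :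
    (∃ K : Matrix (Fin 1) (Fin n) ℝ, SolvesMeanSquareConsensus.{u} G A B σ α K) ∧
    ∀ (δ : ℝ) (Q : Matrix (Fin n) (Fin n) ℝ), Q.PosDef →
      max ((α * lam2 - 1) ^ 2 + α ^ 2 * sMax * lam2)
        ((α * lamN - 1) ^ 2 + α ^ 2 * sMax * lamN) ≤ δ ^ 2 →
      δ ^ 2 < 1 / matrixMahlerMeasure A ^ 2 →
      (∃! P : Matrix (Fin n) (Fin n) ℝ, P.PosDef ∧ SolvesMARE A B Q δ P) ∧
      ∀ P : Matrix (Fin n) (Fin n) ℝ, P.PosDef → SolvesMARE A B Q δ P →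
        SolvesMeanSquareConsensus.{u} G A B σ α (mareGain A B P) := by
  obtain ⟨F, hF⟩ := hAB
  rw [matrix_fin_one_mul_eq_vecMulVec] at hF
  have hmain : ∀ (δ : ℝ) (Q : Matrix (Fin n) (Fin n) ℝ), Q.PosDef →
      max ((α * lam2 - 1) ^ 2 + α ^ 2 * sMax * lam2)
        ((α * lamN - 1) ^ 2 + α ^ 2 * sMax * lamN) ≤ δ ^ 2 →
      δ ^ 2 < 1 / matrixMahlerMeasure A ^ 2 →
      (∃! P : Matrix (Fin n) (Fin n) ℝ, P.PosDef ∧ SolvesMARE A B Q δ P) ∧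
      ∀ P : Matrix (Fin n) (Fin n) ℝ, P.PosDef → SolvesMARE A B Q δ P →
        SolvesMeanSquareConsensus.{u} G A B σ α (mareGain A B P) := by
    intro δ Q hQ hle hlt
    refine ⟨?_, fun P hP hPe => solvesMeanSquareConsensus_mareGain hG hsMax.2 hlam2 hlamN
      ((le_max_left _ _).trans hle) ((le_max_right _ _).trans hle) hQ hP hPe⟩
    refine (existsUnique_congr fun P => and_congr_right fun hP => ?_).mpr
      (existsUnique_modified_riccati_solution hF hQ hlt)
    exact solvesMARE_iff hP.isSymm_real
  refine ⟨?_, hmain⟩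
  set m := max ((α * lam2 - 1) ^ 2 + α ^ 2 * sMax * lam2)
    ((α * lamN - 1) ^ 2 + α ^ 2 * sMax * lamN) with hm
  have hM := one_le_matrixMahlerMeasure A
  -- Taking `δ = √m` and `Q = 1` gives the existence of a gain; the `max` with 0 avoids having to
  -- show `m ≥ 0`.
  have hsq : √m ^ 2 = max m 0 := Real.sq_sqrt'
  obtain ⟨⟨P, ⟨hP, hPe⟩, -⟩, hcons⟩ := hmain (√m) 1 Matrix.PosDef.one
    (by rw [hsq]; exact le_max_left _ _)
    (by rw [hsq]; exact max_lt (max_lt h2 hN') (by positivity))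
  exact ⟨_, hcons P hP hPe⟩
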